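/- Setting. Let $n,m,p\ge 0$ be integers, $A\in\mathbb R^{n\times n}$, $B\in\mathbb R^{n\times m}$ with full row rank ($\operatorname{rank}B=n$), $Q\in\mathbb R^{n\times n}$ and $R\in\mathbb R^{m\times m}$ positive definite, and let $P\succeq 0$ solve the Riccati equation $P=Q+A^\top PA-A^\top PB(R+B^\top PB)^{-1}B^\top PA$. Put $H=B(R+B^\top PB)^{-1}B^\top$ and $F=A-HPA$. Parameters are $\theta=[C,b]$ with $C\in\mathbb R^{n\times p}$, $b\in\mathbb R^n$, with the Euclidean norm of all entries, and the affine decoder is $g_\theta(d)=Cd+b$. Let $\Theta$ be a closed, bounded, convex set of parameters, $\Pi_\Theta$ the Euclidean projection onto it, $\theta_0\in\Theta$, $k\ge 1$ the length of the prediction window, and $(\eta_t)_{t\ge 0}$ a non-increasing sequence of positive learning rates with $\sum_t\eta_t=\infty$ and $\sum_t\eta_t^{r}<\infty$ for some $r\in\mathbb N$ (for instance $\eta_t=c/\sqrt{t+1}$ or $\eta_t=c/(t+1)$ with $c>0$). Data. The disturbances are random vectors $w_\tau\in\mathbb R^n$, almost surely bounded by a common constant, and $d_{\tau|t}\in\mathbb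 R^p$, $t\le\tau$, is the random embedding, available at time $t$, of the context for time $\tau$ (it may depend on $t$). The families $\big((d_{\tau|t})_{t\le\tau},w_\tau\big)$, $\tau=0,1,2,\dots$, are independent, and all pairs $(d_{\tau|t},w_\tau)$, $t\le\tau$, have the same law, that of a pair $(d,w)$. The entries of $d$ are pairwise independent, and every entry of $d$ is uncorrelated with every entry of $w$. Loss and algorithm. For a horizon $T$ and $t\in\{0,\dots,T-1\}$ put $\mathcal T=\min(t+k-1,T-1)$ and $$L_t(\theta)=\hat\psi_t(\theta)^\top H\hat\psi_t(\theta),\qquad \hat\psi_t(\theta)=\sum_{\tau=t}^{\mathcal T}(F^\top)^{\tau-t}Pw_\tau-\sum_{\tau=t}^{\mathcal T}(F^\top)^{\tau-t}Pg_\theta(d_{\tau|t}).$$ Let $\theta_t=[C_t,b_t]$, $0\le t\le T$, start at $\theta_0$ and satisfy $\theta_{t+1}=\Pi_\Theta\big(\theta_t-\eta_t\nabla L_{t-k+1}(\theta_{t-k+1})\big)$ for $0\le t<T$, where $L_{t-k+1}$ is replaced by $0$ if $t<k$. Theorem. Assume that (i) there is a constant $G$ such that, for all $T$ and $t<T$,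 almost surely $\|\nabla L_t(\theta)\|\le G$ for all $\theta\in\Theta$; and (ii) for all $T$ and $t<T$, the expected loss $\theta\mapsto\mathbb E[L_t(\theta)]$ has a unique minimizer over the whole parameter space, and this minimizer lies in the interior of $\Theta$. Then, almost surely, $$\lim_{t\to\infty}C_t=0\qquad\text{and}\qquad\lim_{t\to\infty}b_t=\mathbb E[w],$$ where the limits are uniform over all horizons $T>t$: almost surely, for every $\varepsilon>0$ there is an $N$ such that, for all $T$ and all $t$ with $N\le t<T$, every entry of $C_t$ and of $b_t-\mathbb E[w]$ is less than $\varepsilon$ in absolute value. -/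

import Mathlib

open Matrix MeasureTheory ProbabilityTheory Filter Topology

noncomputable section

namespace InstructMPC

variable {n m p : ℕ}

/-- `P` is the solution of the discrete algebraic Riccati equation: a positive semidefinite matrix
with `P = Q + Aᵀ P A - Aᵀ P B (R + Bᵀ P B)⁻¹ Bᵀ P A`. -/
structure IsDARESolution (A : Matrix (Fin n) (Fin n) ℝ) (B : Matrix (Fin n) (Fin m) ℝ)
    (Q : Matrix (Fin n) (Fin n) ℝ) (R : Matrix (Fin m) (Fin m) ℝ)
    (P : Matrix (Fin n) (Fin n) ℝ) : Prop where
  posSemidef : P.PosSemidef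
  riccati : P = Q + Aᵀ * P * A - Aᵀ * P * B * (R + Bᵀ * P * B)⁻¹ * Bᵀ * P * A

/-- `H = B (R + Bᵀ P B)⁻¹ Bᵀ`. -/
def matH (B : Matrix (Fin n) (Fin m) ℝ) (R : Matrix (Fin m) (Fin m) ℝ)
    (P : Matrix (Fin n) (Fin n) ℝ) : Matrix (Fin n) (Fin n) ℝ :=
  B * (R + Bᵀ * P * B)⁻¹ * Bᵀ

/-- The closed-loop matrix `F = A - H P A`. -/
def matF (A : Matrix (Fin n) (Fin n) ℝ) (B : Matrix (Fin n) (Fin m) ℝ)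
    (R : Matrix (Fin m) (Fin m) ℝ) (P : Matrix (Fin n) (Fin n) ℝ) : Matrix (Fin n) (Fin n) ℝ :=
  A - matH B R P * P * A

/-- Parameters `θ = [C, b]` of the affine decoder, with the Euclidean norm of all their entries:
the coordinates `Sum.inl (i, j)` are the entries of the matrix `C` and the coordinates `Sum.inr i`
are those of the vector `b`. -/
abbrev Param (n p : ℕ) : Type := EuclideanSpace ℝ ((Fin n × Fin p) ⊕ Fin n)

/-- The matrix part `C` of `θ = [C, b]`. -/
def matC (θ : Param n p) : Matrix (Fin n) (Fin p) ℝ := Matrix.of fun i j => θ (Sum.inl (i, j))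

/-- The offset part `b` of `θ = [C, b]`. -/
def vecb (θ : Param n p) : Fin n → ℝ := fun i => θ (Sum.inr i)

/-- The affine decoder `g_θ(d) = C d + b`. -/
def decoder (θ : Param n p) (d : Fin p → ℝ) : Fin n → ℝ := matC θ *ᵥ d + vecb θ

/-- The last index `min (t + k - 1) (T - 1)` of the prediction window that starts at time `t`
(it is used for `1 ≤ k` and `t < T` only). -/
def lastIdx (k T t : ℕ) : ℕ := min (t + k - 1) (T - 1)

/-- The surrogate `ψ̂_t(θ)`, for embeddings `d τ t` (the embedding of time `τ` that is available at
time `t`) and disturbances `w τ`. -/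
def psiHat (A : Matrix (Fin n) (Fin n) ℝ) (B : Matrix (Fin n) (Fin m) ℝ)
    (R : Matrix (Fin m) (Fin m) ℝ) (P : Matrix (Fin n) (Fin n) ℝ) (k T : ℕ)
    (d : ℕ → ℕ → Fin p → ℝ) (w : ℕ → Fin n → ℝ) (t : ℕ) (θ : Param n p) : Fin n → ℝ :=
  ∑ τ ∈ Finset.Icc t (lastIdx k T t), ((matF A B R P)ᵀ ^ (τ - t) * P) *ᵥ w τ
    - ∑ τ ∈ Finset.Icc t (lastIdx k T t), ((matF A B R P)ᵀ ^ (τ - t) * P) *ᵥ decoder θ (d τ t)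

/-- The loss `L_t(θ) = ψ̂_t(θ)ᵀ H ψ̂_t(θ)`. -/
def loss (A : Matrix (Fin n) (Fin n) ℝ) (B : Matrix (Fin n) (Fin m) ℝ)
    (R : Matrix (Fin m) (Fin m) ℝ) (P : Matrix (Fin n) (Fin n) ℝ) (k T : ℕ)
    (d : ℕ → ℕ → Fin p → ℝ) (w : ℕ → Fin n → ℝ) (t : ℕ) (θ : Param n p) : ℝ :=
  psiHat A B R P k T d w t θ ⬝ᵥ (matH B R P *ᵥ psiHat A B R P k T d w t θ)

/-- `y` is the Euclidean projection of `x` onto `Θ`: a point of `Θ` nearest to `x`. -/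
def IsProj {E : Type*} [PseudoMetricSpace E] (Θ : Set E) (x y : E) : Prop :=
  y ∈ Θ ∧ ∀ z ∈ Θ, dist x y ≤ dist x z

/-- `θ 0, …, θ T` are the parameters which the algorithm produces over the horizon `T` with window
length `k`, hypothesis set `Θ`, learning rates `η`, initial parameter `θ₀` and losses `L`:
`θ (t + 1) = Π_Θ (θ t - η t • ∇ L (t - k + 1) (θ (t - k + 1)))` for `t < T`, where the loss
`L (t - k + 1)` is replaced by zero as long as `t < k`. -/
structure IsRun {E : Type*} [NormedAddCommGroup E] [InnerProductSpace ℝ E] [CompleteSpace E]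
    (k T : ℕ) (Θ : Set E) (η : ℕ → ℝ) (θ₀ : E) (L : ℕ → E → ℝ) (θ : ℕ → E) : Prop where
  init : θ 0 = θ₀
  step : ∀ t < T, IsProj Θ
    (θ t - η t • (if t < k then 0 else gradient (L (t + 1 - k)) (θ (t + 1 - k)))) (θ (t + 1))

/-- The filter on pairs `(T, t)` with `t < T` (a horizon and a time before it) that expresses
`t → ∞`: a set belongs to it iff, for some `N`, it contains all `(T, t)` with `N ≤ t < T`. -/
def largeTime : Filter (ℕ × ℕ) := comap Prod.snd atTop ⊓ 𝓟 {q | q.2 < q.1}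

end InstructMPC

end

namespace InstructMPC

/-! The step at time `t` uses the loss of time `s = t - k + 1`, whose window ends at `t < T` and so
is never truncated. Hence runs with different horizons follow one trajectory `x t`
(`IsRun.eq_of_le`), uniformity in `T` is automatic, and it remains to show that `x t` tends almost
surely to `θ* = [0, E w]`.

Expected loss: at `θ*` the residual of a window is a combination of centred disturbances. These are
orthogonal to constants and to every embedding of the window: uncorrelated at equal times,
independent at different ones. The cross term vanishes, and the expected loss at `θ* + v` is its
value at `θ*` plus a nonnegative quadratic form in `v`. Uniqueness of the minimizer identifies it as
`θ*` and makes the form positive definite, which gives quadratic growth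
(`eq_constParam_of_unique_minimizer`). The square integrability of the embeddings needed here is
itself extracted from the unique minimizer at horizon one (`memLp_embedding_of_unique_minimizer`).

Iteration: `x s` depends on data before time `s` only, hence is independent of the window starting
at `s`. With convexity of the loss this yields an expected drift towards `θ*`, even after weighting
by powers of the distance (`le_integral_quadLoss_sub_mul`). Since only some power of `η` is
summable, the Lyapunov function is a high even power of the distance. The errors from the delay and
from second-order terms are absorbed by the drift, up to a summable power of `η`
(`norm_pow_delayed_step_le`, `mul_pow_le_add_pow`). Telescoping expectations shows that the
`η`-weighted sum of powers of the distance is almost surely finite. As the increments are of order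
`η` and `η` is not summable, the distance tends to zero (`tendsto_zero_of_summable_weighted_pow`).
-/

/-! ### Real sequences and one-step estimates. -/

/-- A nonnegative sequence with increments of order `η` is null if its powers are summable with the
non-summable weights `η`. -/
lemma tendsto_zero_of_summable_weighted_pow {η u : ℕ → ℝ} {G : ℝ} {q : ℕ}
    (hη : ∀ t, 0 ≤ η t) (hu : ∀ t, 0 ≤ u t) (hdiv : ¬ Summable η)
    (hinc : ∀ t, |u (t + 1) - u t| ≤ G * η t)
    (hsum : Summable fun t => η t * u t ^ q) (hpow : Summable fun t => η t ^ (q + 1)) :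
    Tendsto u atTop (𝓝 0) := by
  -- Differencing the power `q + 1` leaves the power `q` times an increment of order `η`, which is
  -- exactly the summable quantity. So `u ^ (q + 1)` has summable increments and converges.
  have hstep : ∀ t, dist (u t ^ (q + 1)) (u (t + 1) ^ (q + 1)) ≤
      |G| * (q + 1) * 2 ^ (q - 1) * (η t * u t ^ q)
        + |G| * (q + 1) * 2 ^ (q - 1) * |G| ^ q * η t ^ (q + 1) := by
    intro t
    have hG : |u (t + 1) - u t| ≤ |G| * η t :=
      (hinc t).trans (mul_le_mul_of_nonneg_right (le_abs_self G) (hη t))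
    have hGη : 0 ≤ |G| * η t := mul_nonneg (abs_nonneg _) (hη t)
    have hmax : max |u (t + 1)| |u t| ≤ u t + |G| * η t := by
      rw [abs_of_nonneg (hu _), abs_of_nonneg (hu _)]
      exact max_le (by linarith [(abs_le.1 hG).2]) (by linarith)
    rw [dist_comm, Real.dist_eq]
    calc |u (t + 1) ^ (q + 1) - u t ^ (q + 1)|
        ≤ |u (t + 1) - u t| * ((q + 1 : ℕ) : ℝ) * max |u (t + 1)| |u t| ^ q :=
          abs_pow_sub_pow_le _ _ _
      _ ≤ (|G| * η t) * ((q + 1 : ℕ) : ℝ) * (2 ^ (q - 1) * (u t ^ q + (|G| * η t) ^ q)) := by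
          gcongr
          exact (pow_le_pow_left₀ (by positivity) hmax q).trans (add_pow_le (hu t) hGη q)
      _ = _ := by push_cast; ring
  have hcau : CauchySeq fun t => u t ^ (q + 1) := by
    apply cauchySeq_of_summable_dist
    refine Summable.of_nonneg_of_le (fun _ => dist_nonneg) hstep ?_
    exact (hsum.mul_left _).add (hpow.mul_left _)
  obtain ⟨l, hl⟩ := cauchySeq_tendsto_of_complete hcau
  have hl0 : l = 0 := by
    by_contra hne
    have hlpos : 0 < l := lt_of_le_of_ne
      (ge_of_tendsto' hl fun t => pow_nonneg (hu t) _) (Ne.symm hne)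
    apply hdiv
    have hroot : Tendsto (fun t => (u t ^ (q + 1)) ^ ((q + 1 : ℝ)⁻¹)) atTop
        (𝓝 (l ^ ((q + 1 : ℝ)⁻¹))) := hl.rpow_const (Or.inl hne)
    have hroot' : Tendsto u atTop (𝓝 (l ^ ((q + 1 : ℝ)⁻¹))) := by
      refine hroot.congr fun t => ?_
      have := Real.pow_rpow_inv_natCast (hu t) (Nat.succ_ne_zero q)
      simpa using this
    have hq := hroot'.pow q
    set b := (l ^ ((q + 1 : ℝ)⁻¹)) ^ q with hb
    have hbpos : 0 < b := by positivity
    have hev : ∀ᶠ t in atTop, b / 2 < u t ^ q := hq.eventually (lt_mem_nhds (by linarith))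
    refine Summable.of_norm_bounded_eventually_nat (g := fun t => (b / 2)⁻¹ * (η t * u t ^ q))
      (hsum.mul_left _) ?_
    filter_upwards [hev] with t ht
    rw [Real.norm_of_nonneg (hη t), ← div_eq_inv_mul, le_div_iff₀ (by positivity)]
    exact mul_le_mul_of_nonneg_left ht.le (hη t)
  rw [hl0] at hl
  have hroot : Tendsto (fun t => (u t ^ (q + 1)) ^ ((q + 1 : ℝ)⁻¹)) atTop
      (𝓝 (0 ^ ((q + 1 : ℝ)⁻¹))) := hl.rpow_const (Or.inr (by positivity))
  rw [Real.zero_rpow (by positivity)] at hroot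
  refine hroot.congr fun t => ?_
  have := Real.pow_rpow_inv_natCast (hu t) (Nat.succ_ne_zero q)
  simpa using this

/-- Tangent line inequality for powers. -/
lemma pow_succ_le_pow_succ_add {x y : ℝ} (hx : 0 ≤ x) (hy : 0 ≤ y) (m : ℕ) :
    y ^ (m + 1) ≤ x ^ (m + 1) + (m + 1) * y ^ m * (y - x) := by
  induction m with
  | zero => simp
  | succ m ih =>
    have h1 := mul_le_mul_of_nonneg_left ih hx
    have h2 : 0 ≤ (m + 1) * y ^ m * (y - x) ^ 2 := by positivity
    push_cast
    linear_combination h1 + h2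

/-- Young's inequality in the form needed below. -/
lemma mul_pow_le_add_pow (l : ℕ) {κ σ₀ : ℝ} (hκ : 0 < κ) (hσ₀ : 0 ≤ σ₀) :
    ∃ C : ℝ, 0 ≤ C ∧ ∀ a σ : ℝ, 0 ≤ a → 0 ≤ σ → σ ≤ σ₀ →
      σ * (a + σ) ^ (2 * (l + 1)) ≤ κ * a ^ (2 * (l + 2)) + C * σ ^ (l + 2) := by
  set ε : ℝ := κ / 2 ^ (2 * (l + 2) - 1) with hε
  have hεpos : 0 < ε := by positivity
  refine ⟨κ * σ₀ ^ (l + 2) + (ε⁻¹) ^ (l + 1), by positivity, fun a σ ha hσ hσσ => ?_⟩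
  set r := a + σ with hr
  have hr0 : 0 ≤ r := by positivity
  -- Either `σ` is small against `r ^ 2` and is traded for two more powers of `r`, or `r ^ 2` is at
  -- most `σ / ε` and everything is a power of `σ`. The denominator of `ε` cancels the constant of
  -- `add_pow_le`.
  by_cases h : σ ≤ ε * r ^ 2
  · calc σ * r ^ (2 * (l + 1)) ≤ ε * r ^ 2 * r ^ (2 * (l + 1)) := by gcongr
      _ = ε * r ^ (2 * (l + 2)) := by ring
      _ ≤ ε * (2 ^ (2 * (l + 2) - 1) * (a ^ (2 * (l + 2)) + σ ^ (2 * (l + 2)))) := by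
          gcongr; exact add_pow_le ha hσ _
      _ = κ * a ^ (2 * (l + 2)) + κ * (σ ^ (l + 2) * σ ^ (l + 2)) := by
          rw [hε]; field_simp; ring
      _ ≤ κ * a ^ (2 * (l + 2)) + κ * (σ₀ ^ (l + 2) * σ ^ (l + 2)) := by gcongr
      _ ≤ _ := by
          have : 0 ≤ (ε⁻¹) ^ (l + 1) * σ ^ (l + 2) := by positivity
          linarith
  · have h' : r ^ 2 ≤ ε⁻¹ * σ := by
      rw [← div_eq_inv_mul, le_div_iff₀ hεpos]; linarith
    calc σ * r ^ (2 * (l + 1)) = σ * (r ^ 2) ^ (l + 1) := by rw [pow_mul]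
      _ ≤ σ * (ε⁻¹ * σ) ^ (l + 1) := by gcongr
      _ = (ε⁻¹) ^ (l + 1) * σ ^ (l + 2) := by ring
      _ ≤ _ := by
          have h1 : 0 ≤ κ * a ^ (2 * (l + 2)) := by positivity
          have h2 : 0 ≤ κ * σ₀ ^ (l + 2) * σ ^ (l + 2) := by positivity
          linarith

/-- One step of a gradient iteration with a delayed gradient `g`, which belongs to the point
`a = e - δ`. -/
lemma norm_pow_delayed_step_le {E : Type*} [NormedAddCommGroup E] [InnerProductSpace ℝ E]
    (l : ℕ) {G L : ℝ} (hG : 0 ≤ G) (hL : 0 ≤ L) :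
    ∃ C : ℝ, 0 ≤ C ∧ ∀ (a e g : E) (h σ Y : ℝ), 0 ≤ h → h ≤ σ → ‖g‖ ≤ G → ‖e - a‖ ≤ L * σ →
      Y ≤ inner ℝ g a →
      ‖e - h • g‖ ^ (2 * (l + 2)) ≤ ‖e‖ ^ (2 * (l + 2))
        - 2 * (l + 2) * h * (Y * ‖a‖ ^ (2 * (l + 1)))
        + C * h * (σ * (‖a‖ + σ) ^ (2 * (l + 1))) := by
  -- With `y` the new squared distance and `r = ‖a‖ + σ`: `K` bounds the error in the decrease of
  -- the squared norm, `C₁` the size of `y - ‖e‖ ^ 2` (order `h * r`), `C₂` that of `y - ‖a‖ ^ 2`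
  -- (order `σ * r`), and `C₃` the latter after taking powers.
  set K : ℝ := 2 * G * L + G ^ 2 with hK
  set C₁ : ℝ := 2 * G * (1 + L) + G ^ 2 with hC₁
  set C₂ : ℝ := (L + G) * (2 + L + G) with hC₂
  set C₃ : ℝ := C₂ * (l + 1) * ((1 + L + G) ^ 2) ^ l with hC₃
  refine ⟨(l + 2) * K + (l + 2) * (C₃ * C₁), by positivity,
    fun a e g h σ Y hh hhσ hg hδ hY => ?_⟩
  have hσ : 0 ≤ σ := hh.trans hhσ
  set r := ‖a‖ + σ with hr
  have hr0 : 0 ≤ r := by positivity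
  have har : ‖a‖ ≤ r := by linarith
  have hσr : σ ≤ r := by linarith [norm_nonneg a]
  set y := ‖e - h • g‖ ^ 2 with hy
  have hy0 : 0 ≤ y := by positivity
  have hyx : y - ‖e‖ ^ 2 = -2 * h * inner ℝ g e + h ^ 2 * ‖g‖ ^ 2 := by
    rw [hy, norm_sub_sq_real, inner_smul_right, norm_smul, Real.norm_of_nonneg hh,
      real_inner_comm]
    ring
  have hge : inner ℝ g e = inner ℝ g a + inner ℝ g (e - a) := by
    rw [← inner_add_right, add_sub_cancel]
  have hgδ : |inner ℝ g (e - a)| ≤ G * (L * σ) :=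
    (abs_real_inner_le_norm _ _).trans (mul_le_mul hg hδ (norm_nonneg _) hG)
  have hg2 : h ^ 2 * ‖g‖ ^ 2 ≤ h * (σ * G ^ 2) := by
    have : ‖g‖ ^ 2 ≤ G ^ 2 := pow_le_pow_left₀ (norm_nonneg _) hg 2
    calc h ^ 2 * ‖g‖ ^ 2 = h * (h * ‖g‖ ^ 2) := by ring
      _ ≤ h * (σ * G ^ 2) := by gcongr
  have hyx1 : y - ‖e‖ ^ 2 ≤ -2 * h * Y + K * h * σ := by
    have h1 := mul_le_mul_of_nonneg_left hY hh
    have h2 := mul_le_mul_of_nonneg_left (abs_le.1 hgδ).1 hh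
    rw [hyx, hge, hK]
    nlinarith
  have he : ‖e‖ ≤ (1 + L) * r := by
    have : ‖e‖ ≤ ‖a‖ + ‖e - a‖ := by
      have := norm_add_le a (e - a); rwa [add_sub_cancel] at this
    nlinarith [mul_le_mul_of_nonneg_left hσr hL]
  have hyx2 : |y - ‖e‖ ^ 2| ≤ C₁ * h * r := by
    have h1 : |inner ℝ g e| ≤ G * ((1 + L) * r) :=
      (abs_real_inner_le_norm _ _).trans (mul_le_mul hg he (norm_nonneg _) hG)
    have h2 : |-2 * h * inner ℝ g e| ≤ 2 * h * (G * ((1 + L) * r)) := by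
      rw [abs_mul, abs_mul, abs_of_nonneg hh]
      simp only [abs_neg, Nat.abs_ofNat]
      gcongr
    have h3 : h * (σ * G ^ 2) ≤ h * (r * G ^ 2) := by gcongr
    have h4 : (0 : ℝ) ≤ h ^ 2 * ‖g‖ ^ 2 := by positivity
    rw [hyx, hC₁]
    refine (abs_add_le _ _).trans ?_
    rw [abs_of_nonneg h4]
    linarith
  have hsg : ‖h • g‖ ≤ σ * G := by
    rw [norm_smul, Real.norm_of_nonneg hh]; gcongr
  have hnorm : ‖e - h • g‖ ≤ ‖a‖ + (L + G) * σ := by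
    have h1 : e - h • g = a + (e - a) - h • g := by abel
    rw [h1]
    linarith [norm_sub_le (a + (e - a)) (h • g), norm_add_le a (e - a)]
  have hnorm' : |‖e - h • g‖ - ‖a‖| ≤ (L + G) * σ := by
    refine (abs_norm_sub_norm_le _ _).trans ?_
    have h1 : e - h • g - a = (e - a) - h • g := by abel
    rw [h1]
    linarith [norm_sub_le (e - a) (h • g)]
  have hLGσ : (L + G) * σ ≤ (L + G) * r := by gcongr
  have hyz : |y - ‖a‖ ^ 2| ≤ C₂ * σ * r := by
    have h1 : y - ‖a‖ ^ 2 = (‖e - h • g‖ - ‖a‖) * (‖e - h • g‖ + ‖a‖) := by rw [hy]; ring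
    rw [h1, abs_mul, abs_of_nonneg (add_nonneg (norm_nonneg _) (norm_nonneg _))]
    calc _ ≤ ((L + G) * σ) * ((2 + L + G) * r) := by
          gcongr; linarith
      _ = _ := by rw [hC₂]; ring
  have hmax : max |y| |‖a‖ ^ 2| ≤ (1 + L + G) ^ 2 * r ^ 2 := by
    rw [abs_of_nonneg hy0, abs_of_nonneg (by positivity), ← mul_pow]
    refine max_le (pow_le_pow_left₀ (norm_nonneg _) (by linarith) 2)
      (pow_le_pow_left₀ (norm_nonneg _) ?_ 2)
    nlinarith [mul_nonneg (add_nonneg hL hG) hr0]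
  have hpow : |y ^ (l + 1) - (‖a‖ ^ 2) ^ (l + 1)| ≤ C₃ * (σ * r * r ^ (2 * l)) := by
    refine (abs_pow_sub_pow_le _ _ _).trans ?_
    calc _ ≤ (C₂ * σ * r) * ((l + 1 : ℕ) : ℝ) * ((1 + L + G) ^ 2 * r ^ 2) ^ l := by
          rw [Nat.add_sub_cancel]; gcongr
      _ = _ := by rw [hC₃, mul_pow, ← pow_mul r]; push_cast; ring
  have htan := pow_succ_le_pow_succ_add (sq_nonneg ‖e‖) hy0 (l + 1)
  have hfirst : (‖a‖ ^ 2) ^ (l + 1) * (y - ‖e‖ ^ 2) ≤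
      -2 * h * (Y * ‖a‖ ^ (2 * (l + 1))) + K * h * (σ * r ^ (2 * (l + 1))) := by
    rw [← pow_mul]
    have h1 : ‖a‖ ^ (2 * (l + 1)) ≤ r ^ (2 * (l + 1)) :=
      pow_le_pow_left₀ (norm_nonneg _) har _
    have h2 : K * h * σ * ‖a‖ ^ (2 * (l + 1)) ≤ K * h * σ * r ^ (2 * (l + 1)) := by gcongr
    have h3 := mul_le_mul_of_nonneg_left hyx1 (pow_nonneg (norm_nonneg a) (2 * (l + 1)))
    linarith
  have hsecond : (y ^ (l + 1) - (‖a‖ ^ 2) ^ (l + 1)) * (y - ‖e‖ ^ 2) ≤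
      C₃ * C₁ * h * (σ * r ^ (2 * (l + 1))) := by
    refine (le_abs_self _).trans ?_
    rw [abs_mul]
    calc _ ≤ (C₃ * (σ * r * r ^ (2 * l))) * (C₁ * h * r) := by gcongr
      _ = _ := by ring
  -- The tangent inequality puts the weight `y ^ (l + 1)` on the decrease, but the drift can only be
  -- averaged with a weight depending on `a` alone. Exchanging the weights costs a product of two
  -- differences, of order `σ * h`.
  have hsplit : (((l + 1 : ℕ) : ℝ) + 1) * y ^ (l + 1) * (y - ‖e‖ ^ 2) =
      (l + 2) * ((‖a‖ ^ 2) ^ (l + 1) * (y - ‖e‖ ^ 2)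
        + (y ^ (l + 1) - (‖a‖ ^ 2) ^ (l + 1)) * (y - ‖e‖ ^ 2)) := by
    push_cast; ring
  have hl2 : (0 : ℝ) ≤ l + 2 := by positivity
  have hfin := mul_le_mul_of_nonneg_left (add_le_add hfirst hsecond) hl2
  rw [hsplit] at htan
  rw [pow_mul, pow_mul ‖e‖, ← hy]
  refine htan.trans ((add_le_add_right hfin _).trans (le_of_eq ?_))
  rw [hr]; ring

lemma summable_pow_of_le {η : ℕ → ℝ} (hη : ∀ t, 0 ≤ η t) (hanti : Antitone η) {r q : ℕ}
    (hrq : r ≤ q) (hs : Summable fun t => η t ^ r) : Summable fun t => η t ^ q := by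
  refine Summable.of_nonneg_of_le (fun t => pow_nonneg (hη t) q) (fun t => ?_)
    (hs.mul_left (η 0 ^ (q - r)))
  calc η t ^ q = η t ^ (q - r) * η t ^ r := by rw [← pow_add, Nat.sub_add_cancel hrq]
    _ ≤ η 0 ^ (q - r) * η t ^ r := by
        gcongr
        · exact pow_nonneg (hη t) r
        · exact hη t
        · exact hanti (Nat.zero_le t)

/-- A sequence of nonnegative random variables with summable expectations is almost surely
summable. -/
lemma ae_summable_of_summable_integral {Ω : Type*} [MeasurableSpace Ω] {μ : Measure Ω}
    {f : ℕ → Ω → ℝ} (hf : ∀ t ω, 0 ≤ f t ω) (hint : ∀ t, Integrable (f t) μ)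
    (hs : Summable fun t => ∫ ω, f t ω ∂μ) : ∀ᵐ ω ∂μ, Summable fun t => f t ω := by
  have hlin : ∫⁻ ω, ∑' t, ENNReal.ofReal (f t ω) ∂μ ≠ ⊤ := by
    rw [lintegral_tsum fun t => (hint t).aemeasurable.ennreal_ofReal]
    have : ∀ t, ∫⁻ ω, ENNReal.ofReal (f t ω) ∂μ = ENNReal.ofReal (∫ ω, f t ω ∂μ) := fun t =>
      (ofReal_integral_eq_lintegral_ofReal (hint t) (ae_of_all _ (hf t))).symm
    simp_rw [this]
    exact hs.tsum_ofReal_ne_top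
  have hae := ae_lt_top' (AEMeasurable.tsum fun t => (hint t).aemeasurable.ennreal_ofReal)
    hlin
  filter_upwards [hae] with ω hω
  have := ENNReal.summable_toReal hω.ne
  simpa [ENNReal.toReal_ofReal (hf _ ω)] using this

lemma norm_sub_le_of_norm_succ_sub_le {E : Type*} [SeminormedAddCommGroup E] {y : ℕ → E} {η : ℕ → ℝ}
    {G : ℝ} (hG : 0 ≤ G) (hη0 : ∀ t, 0 ≤ η t) (hη_anti : Antitone η)
    (hinc : ∀ t, ‖y (t + 1) - y t‖ ≤ G * η t) {k : ℕ} (hk : 1 ≤ k) (j : ℕ) :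
    ‖y (j + k) - y (j + 1)‖ ≤ k * G * η (j + 1) := by
  have hi : ∀ i : ℕ, ‖y (j + 1 + i) - y (j + 1)‖ ≤ i * (G * η (j + 1)) := by
    intro i
    induction i with
    | zero => simp
    | succ i ih =>
      have h1 := (hinc (j + 1 + i)).trans
        (mul_le_mul_of_nonneg_left (hη_anti (Nat.le_add_right (j + 1) i)) hG)
      have h2 := norm_add_le (y (j + 1 + i + 1) - y (j + 1 + i)) (y (j + 1 + i) - y (j + 1))
      rw [sub_add_sub_cancel] at h2
      rw [← add_assoc]
      push_cast
      linarith
  have h1 := hi (k - 1)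
  rw [show j + 1 + (k - 1) = j + k by omega] at h1
  refine h1.trans ?_
  have : ((k - 1 : ℕ) : ℝ) ≤ k := by exact_mod_cast Nat.sub_le k 1
  rw [mul_assoc]
  exact mul_le_mul_of_nonneg_right this (mul_nonneg hG (hη0 _))

/-- A sequence with increments of order `η` converges to `xs` if the powers of its lagged distances
from `xs` are summable with the weights `η`. -/
lemma tendsto_of_summable_lagged {E : Type*} [SeminormedAddCommGroup E] {y : ℕ → E} {xs : E}
    {η : ℕ → ℝ} {G : ℝ} (hG : 0 ≤ G) (hη0 : ∀ t, 0 ≤ η t) (hη_anti : Antitone η)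
    (hη_div : ¬ Summable η) (hinc : ∀ t, ‖y (t + 1) - y t‖ ≤ G * η t) {k : ℕ} (hk : 1 ≤ k) {Q : ℕ}
    (hpow : Summable fun t => η t ^ (Q + 1))
    (hsum : Summable fun j => η (j + k) * ‖y (j + 1) - xs‖ ^ Q) : Tendsto y atTop (𝓝 xs) := by
  have hlag := norm_sub_le_of_norm_succ_sub_le hG hη0 hη_anti hinc hk
  have hhσ : ∀ j, η (j + k) ≤ η (j + 1) := fun j => hη_anti (by omega)
  have hu : Tendsto (fun j => ‖y (j + k) - xs‖) atTop (𝓝 0) := by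
    refine tendsto_zero_of_summable_weighted_pow (η := fun j => η (j + k)) (G := G)
      (q := Q) (fun j => hη0 _) (fun j => norm_nonneg _)
      (fun h => hη_div ((summable_nat_add_iff k).1 h)) (fun j => ?_) ?_
      ((summable_nat_add_iff k).2 hpow)
    · refine (abs_norm_sub_norm_le _ _).trans ?_
      rw [sub_sub_sub_cancel_right, show j + 1 + k = j + k + 1 by omega]
      exact hinc _
    · set M : ℝ := 2 ^ (Q - 1) with hM
      have hpow' : Summable fun j => η (j + 1) ^ (Q + 1) := (summable_nat_add_iff 1).2 hpow
      refine Summable.of_nonneg_of_le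
        (fun j => mul_nonneg (hη0 _) (pow_nonneg (norm_nonneg _) _)) (fun j => ?_)
        ((hsum.mul_left M).add (hpow'.mul_left (M * (k * G) ^ Q)))
      have h1 : ‖y (j + k) - xs‖ ≤ ‖y (j + 1) - xs‖ + k * G * η (j + 1) := by
        have := norm_add_le (y (j + 1) - xs) (y (j + k) - y (j + 1))
        rw [add_comm (y (j + 1) - xs), sub_add_sub_cancel] at this
        linarith [hlag j]
      have h0 : 0 ≤ k * G * η (j + 1) := mul_nonneg (by positivity) (hη0 _)
      calc η (j + k) * ‖y (j + k) - xs‖ ^ Q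
          ≤ η (j + k) * (M * (‖y (j + 1) - xs‖ ^ Q + (k * G * η (j + 1)) ^ Q)) := by
            refine mul_le_mul_of_nonneg_left ?_ (hη0 _)
            exact (pow_le_pow_left₀ (norm_nonneg _) h1 _).trans
              (add_pow_le (norm_nonneg _) h0 _)
        _ = M * (η (j + k) * ‖y (j + 1) - xs‖ ^ Q)
              + M * (k * G * η (j + 1)) ^ Q * η (j + k) := by ring
        _ ≤ M * (η (j + k) * ‖y (j + 1) - xs‖ ^ Q)
              + M * (k * G * η (j + 1)) ^ Q * η (j + 1) := by
            have := hhσ j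
            gcongr
        _ = _ := by rw [mul_pow]; ring
  exact tendsto_iff_norm_sub_tendsto_zero.2 ((tendsto_add_atTop_iff_nat k).1 hu)

/-! ### Almost sure convergence of iterations with delayed gradients. -/

/-- For a bounded iteration with delayed gradients whose expected drift points towards `xs`, the
powers of the distances from `xs` are almost surely summable with the learning rates as weights. -/
theorem ae_summable_of_delayed_gradient_step {E : Type*} [NormedAddCommGroup E]
    [InnerProductSpace ℝ E] {Ω : Type*} [MeasurableSpace Ω] {μ : Measure Ω}
    [IsProbabilityMeasure μ] {k : ℕ} (hk : 1 ≤ k) {η : ℕ → ℝ}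
    (hη_pos : ∀ t, 0 < η t) (hη_anti : Antitone η)
    {l : ℕ} (hη_pow : Summable fun t => η t ^ (l + 3))
    {x g : ℕ → Ω → E} {xs : E} {D G c : ℝ} (hG : 0 ≤ G) (hc : 0 < c)
    (hx_meas : ∀ t, Measurable fun ω => ‖x t ω - xs‖) (hx_bdd : ∀ t ω, ‖x t ω - xs‖ ≤ D)
    (hg : ∀ᵐ ω ∂μ, ∀ s, ‖g s ω‖ ≤ G)
    (hinc : ∀ᵐ ω ∂μ, ∀ t, ‖x (t + 1) ω - x t ω‖ ≤ G * η t)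
    (hstep : ∀ᵐ ω ∂μ, ∀ j,
      ‖x (j + k + 1) ω - xs‖ ≤ ‖x (j + k) ω - η (j + k) • g (j + 1) ω - xs‖)
    {Y : ℕ → Ω → ℝ} (hY_int : ∀ s, Integrable (Y s) μ)
    (hY : ∀ᵐ ω ∂μ, ∀ s, Y s ω ≤ inner ℝ (g s ω) (x s ω - xs))
    (hdrift : ∀ s m, c * ∫ ω, ‖x s ω - xs‖ ^ (m + 2) ∂μ ≤ ∫ ω, Y s ω * ‖x s ω - xs‖ ^ m ∂μ) :
    ∀ᵐ ω ∂μ, Summable fun j => η (j + k) * ‖x (j + 1) ω - xs‖ ^ (2 * (l + 2)) := by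
  have hη0 : ∀ t, 0 ≤ η t := fun t => (hη_pos t).le
  obtain ⟨C, hC0, hC⟩ := norm_pow_delayed_step_le (E := E) l hG (L := k * G) (by positivity)
  -- The drift supplies `2 * (l + 2) * c`; the error may consume half of it. The `+ 1` covers `C =
  -- 0`.
  set κ : ℝ := (l + 2) * c / (C + 1) with hκ
  have hκpos : 0 < κ := by positivity
  have hCκ : C * κ ≤ (l + 2) * c := by
    rw [hκ, mul_div_assoc', div_le_iff₀ (by positivity)]
    have : 0 ≤ (l + 2) * c := by positivity
    nlinarith
  obtain ⟨C', hC'0, hC'⟩ := mul_pow_le_add_pow l hκpos (hη0 0)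
  have hhσ : ∀ j, η (j + k) ≤ η (j + 1) := fun j => hη_anti (by omega)
  have hlag : ∀ᵐ ω ∂μ, ∀ j, ‖x (j + k) ω - x (j + 1) ω‖ ≤ k * G * η (j + 1) :=
    hinc.mono fun ω hω =>
      norm_sub_le_of_norm_succ_sub_le (y := fun t => x t ω) hG hη0 hη_anti hω hk
  have hpt : ∀ᵐ ω ∂μ, ∀ j, ‖x (j + k + 1) ω - xs‖ ^ (2 * (l + 2)) ≤
      ‖x (j + k) ω - xs‖ ^ (2 * (l + 2))
        - 2 * (l + 2) * η (j + k) * (Y (j + 1) ω * ‖x (j + 1) ω - xs‖ ^ (2 * (l + 1)))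
        + (l + 2) * c * η (j + k) * ‖x (j + 1) ω - xs‖ ^ (2 * (l + 2))
        + C * C' * η (j + 1) ^ (l + 3) := by
    filter_upwards [hg, hlag, hstep, hY] with ω h1 h2 h3 h4 j
    have hA := hC (x (j + 1) ω - xs) (x (j + k) ω - xs) (g (j + 1) ω) (η (j + k)) (η (j + 1))
      (Y (j + 1) ω) (hη0 _) (hhσ j) (h1 _) (by simpa using h2 j) (h4 _)
    have hB := hC' ‖x (j + 1) ω - xs‖ (η (j + 1)) (norm_nonneg _) (hη0 _) (hη_anti (Nat.zero_le _))
    have hle : ‖x (j + k + 1) ω - xs‖ ^ (2 * (l + 2)) ≤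
        ‖x (j + k) ω - xs - η (j + k) • g (j + 1) ω‖ ^ (2 * (l + 2)) := by
      refine pow_le_pow_left₀ (norm_nonneg _) ((h3 j).trans (le_of_eq ?_)) _
      congr 1; abel
    have hB' := mul_le_mul_of_nonneg_left hB (mul_nonneg hC0 (hη0 (j + k)))
    have hpow0 : 0 ≤ ‖x (j + 1) ω - xs‖ ^ (2 * (l + 2)) := by positivity
    have h5 : C * κ * (η (j + k) * ‖x (j + 1) ω - xs‖ ^ (2 * (l + 2))) ≤
        (l + 2) * c * (η (j + k) * ‖x (j + 1) ω - xs‖ ^ (2 * (l + 2))) :=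
      mul_le_mul_of_nonneg_right hCκ (mul_nonneg (hη0 _) hpow0)
    have h6 : C * C' * η (j + 1) ^ (l + 2) * η (j + k) ≤
        C * C' * η (j + 1) ^ (l + 2) * η (j + 1) :=
      mul_le_mul_of_nonneg_left (hhσ j) (by have := hη0 (j + 1); positivity)
    rw [show l + 3 = l + 2 + 1 from rfl, pow_succ (η (j + 1))]
    linarith
  have hbdd : ∀ t (m : ℕ) ω, ‖‖x t ω - xs‖ ^ m‖ ≤ D ^ m := fun t m ω => by
    rw [norm_pow, norm_norm]
    exact pow_le_pow_left₀ (norm_nonneg _) (hx_bdd t ω) m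
  have hint : ∀ t (m : ℕ), Integrable (fun ω => ‖x t ω - xs‖ ^ m) μ := fun t m =>
    Integrable.of_bound ((hx_meas t).pow_const m).aestronglyMeasurable (D ^ m)
      (ae_of_all _ (hbdd t m))
  have hintY : ∀ t (m : ℕ), Integrable (fun ω => Y t ω * ‖x t ω - xs‖ ^ m) μ := fun t m =>
    (hY_int t).mul_bdd ((hx_meas t).pow_const m).aestronglyMeasurable
      (ae_of_all _ (hbdd t m))
  set A : ℕ → ℝ := fun t => ∫ ω, ‖x t ω - xs‖ ^ (2 * (l + 2)) ∂μ with hA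
  have hA0 : ∀ t, 0 ≤ A t := fun t => integral_nonneg fun ω => by positivity
  have hrec : ∀ j, (l + 2) * c * (η (j + k) * A (j + 1)) ≤
      A (j + k) - A (j + k + 1) + C * C' * η (j + 1) ^ (l + 3) := by
    intro j
    have h1 : A (j + k + 1) ≤ A (j + k)
        - 2 * (l + 2) * η (j + k) * (∫ ω, Y (j + 1) ω * ‖x (j + 1) ω - xs‖ ^ (2 * (l + 1)) ∂μ)
        + (l + 2) * c * η (j + k) * A (j + 1) + C * C' * η (j + 1) ^ (l + 3) := by
      have i1 := hint (j + k) (2 * (l + 2))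
      have i2 := (hintY (j + 1) (2 * (l + 1))).const_mul (2 * (l + 2) * η (j + k))
      have i3 := (hint (j + 1) (2 * (l + 2))).const_mul ((l + 2) * c * η (j + k))
      have i4 := integrable_const (μ := μ) (C * C' * η (j + 1) ^ (l + 3))
      have := integral_mono_ae (hint (j + k + 1) (2 * (l + 2)))
        (((i1.sub i2).add i3).add i4) (hpt.mono fun ω h => h j)
      refine this.trans (le_of_eq ?_)
      rw [integral_add' ((i1.sub i2).add i3) i4, integral_add' (i1.sub i2) i3, integral_sub' i1 i2,
        integral_const_mul, integral_const_mul]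
      simp [hA]
    have h2 : c * A (j + 1) ≤ ∫ ω, Y (j + 1) ω * ‖x (j + 1) ω - xs‖ ^ (2 * (l + 1)) ∂μ :=
      hdrift (j + 1) (2 * (l + 1))
    have h3 := mul_le_mul_of_nonneg_left h2
      (mul_nonneg (by positivity : (0 : ℝ) ≤ 2 * (l + 2)) (hη0 (j + k)))
    linarith
  have hpow1 : Summable fun j => η (j + 1) ^ (l + 3) :=
    (summable_nat_add_iff 1).2 hη_pow
  have hsumA : Summable fun j => η (j + k) * A (j + 1) := by
    have hlc : (0 : ℝ) < (l + 2) * c := by positivity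
    have hs : Summable fun j => (l + 2) * c * (η (j + k) * A (j + 1)) := by
      -- The gain sits at the delayed index `j + 1` and the decrease at `j + k`; only the decrease
      -- has to telescope.
      refine summable_of_sum_range_le (c := A k + C * C' * ∑' j, η (j + 1) ^ (l + 3))
        (fun j => mul_nonneg hlc.le (mul_nonneg (hη0 _) (hA0 _))) fun N => ?_
      have htel : ∑ j ∈ Finset.range N, (A (j + k) - A (j + k + 1)) = A k - A (N + k) := by
        have := Finset.sum_range_sub' (fun j => A (j + k)) N
        simp only [zero_add] at this
        rw [← this]
        exact Finset.sum_congr rfl fun j _ => by rw [show j + 1 + k = j + k + 1 by omega]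
      have hpart := hpow1.sum_le_tsum (Finset.range N)
        (fun j _ => pow_nonneg (hη0 (j + 1)) (l + 3))
      calc _ ≤ ∑ j ∈ Finset.range N, (A (j + k) - A (j + k + 1) + C * C' * η (j + 1) ^ (l + 3)) :=
            Finset.sum_le_sum fun j _ => hrec j
        _ = A k - A (N + k) + C * C' * ∑ j ∈ Finset.range N, η (j + 1) ^ (l + 3) := by
            rw [Finset.sum_add_distrib, htel, Finset.mul_sum]
        _ ≤ _ := by
            have := mul_le_mul_of_nonneg_left hpart (mul_nonneg hC0 hC'0)
            linarith [hA0 (N + k)]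
    exact (summable_mul_left_iff hlc.ne').1 hs
  refine ae_summable_of_summable_integral
    (fun j ω => mul_nonneg (hη0 _) (pow_nonneg (norm_nonneg _) _))
    (fun j => (hint (j + 1) (2 * (l + 2))).const_mul _) ?_
  simpa only [integral_const_mul] using hsumA

/-- A bounded iteration with delayed gradients whose expected drift points towards `xs` converges
almost surely to `xs`. -/
theorem ae_tendsto_of_delayed_gradient_step {E : Type*} [NormedAddCommGroup E]
    [InnerProductSpace ℝ E] {Ω : Type*} [MeasurableSpace Ω] {μ : Measure Ω}
    [IsProbabilityMeasure μ] {k : ℕ} (hk : 1 ≤ k) {η : ℕ → ℝ}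
    (hη_pos : ∀ t, 0 < η t) (hη_anti : Antitone η)
    (hη_div : ¬ Summable η) (hη_pow : ∃ r : ℕ, Summable fun t => η t ^ r)
    {x g : ℕ → Ω → E} {xs : E} {D G c : ℝ} (hG : 0 ≤ G) (hc : 0 < c)
    (hx_meas : ∀ t, Measurable fun ω => ‖x t ω - xs‖) (hx_bdd : ∀ t ω, ‖x t ω - xs‖ ≤ D)
    (hg : ∀ᵐ ω ∂μ, ∀ s, ‖g s ω‖ ≤ G)
    (hinc : ∀ᵐ ω ∂μ, ∀ t, ‖x (t + 1) ω - x t ω‖ ≤ G * η t)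
    (hstep : ∀ᵐ ω ∂μ, ∀ j,
      ‖x (j + k + 1) ω - xs‖ ≤ ‖x (j + k) ω - η (j + k) • g (j + 1) ω - xs‖)
    {Y : ℕ → Ω → ℝ} (hY_int : ∀ s, Integrable (Y s) μ)
    (hY : ∀ᵐ ω ∂μ, ∀ s, Y s ω ≤ inner ℝ (g s ω) (x s ω - xs))
    (hdrift : ∀ s m, c * ∫ ω, ‖x s ω - xs‖ ^ (m + 2) ∂μ ≤ ∫ ω, Y s ω * ‖x s ω - xs‖ ^ m ∂μ) :
    ∀ᵐ ω ∂μ, Tendsto (fun t => x t ω) atTop (𝓝 xs) := by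
  obtain ⟨r, hr⟩ := hη_pow
  have hη0 : ∀ t, 0 ≤ η t := fun t => (hη_pos t).le
  have hpow : ∀ m, r ≤ m → Summable fun t => η t ^ m := fun m hm =>
    summable_pow_of_le hη0 hη_anti hm hr
  -- This fixes `l = r`: the exponent of the Lyapunov function is dictated by the summable power of
  -- `η`.
  have hsum := ae_summable_of_delayed_gradient_step hk hη_pos hη_anti (hpow (r + 3) (by omega)) hG hc
    hx_meas hx_bdd hg hinc hstep hY_int hY hdrift
  filter_upwards [hsum, hinc] with ω hω hincω
  exact tendsto_of_summable_lagged hG hη0 hη_anti hη_div hincω hk (hpow _ (by omega)) hω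

/-! ### The affine decoder and the quadratic loss of a window. -/

variable {n m p K : ℕ}

lemma decoder_add (u v : Param n p) (d : Fin p → ℝ) :
    decoder (u + v) d = decoder u d + decoder v d := by
  ext i
  simp [decoder, matC, vecb, mulVec, dotProduct, add_mul, Finset.sum_add_distrib]
  ring

lemma decoder_smul (r : ℝ) (v : Param n p) (d : Fin p → ℝ) :
    decoder (r • v) d = r • decoder v d := by
  ext i
  simp [decoder, matC, vecb, mulVec, dotProduct, mul_assoc, Finset.mul_sum, mul_add]

lemma decoder_apply (θ : Param n p) (d : Fin p → ℝ) (i : Fin n) :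
    decoder θ d i = ∑ j, θ (Sum.inl (i, j)) * d j + θ (Sum.inr i) := by
  simp [decoder, matC, vecb, mulVec, dotProduct]

/-- The data of a prediction window of length `K`: pairs of an embedding and a disturbance. -/
abbrev Window (n p K : ℕ) : Type := Fin K → (Fin p → ℝ) × (Fin n → ℝ)

/-- The weighted prediction error of the decoder with parameter `θ` over a window. -/
def resid (M : Fin K → Matrix (Fin n) (Fin n) ℝ) (z : Window n p K) (θ : Param n p) : Fin n → ℝ :=
  ∑ j, M j *ᵥ ((z j).2 - decoder θ (z j).1)

/-- The weighted prediction of the decoder with parameter `v` over a window. -/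
def pred (M : Fin K → Matrix (Fin n) (Fin n) ℝ) (z : Window n p K) (v : Param n p) : Fin n → ℝ :=
  ∑ j, M j *ᵥ decoder v (z j).1

/-- The quadratic form of a matrix. -/
def qform (H : Matrix (Fin n) (Fin n) ℝ) (x : Fin n → ℝ) : ℝ := x ⬝ᵥ (H *ᵥ x)

section Algebra

variable (M : Fin K → Matrix (Fin n) (Fin n) ℝ) (z : Window n p K)

lemma pred_add (u v : Param n p) : pred M z (u + v) = pred M z u + pred M z v := by
  simp [pred, decoder_add, mulVec_add, Finset.sum_add_distrib]

lemma pred_smul (r : ℝ) (v : Param n p) : pred M z (r • v) = r • pred M z v := by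
  simp [pred, decoder_smul, mulVec_smul, Finset.smul_sum]

lemma resid_add (θ v : Param n p) : resid M z (θ + v) = resid M z θ - pred M z v := by
  simp only [resid, pred, decoder_add, ← Finset.sum_sub_distrib, ← mulVec_sub, sub_sub]

end Algebra

section QuadraticForm

variable {H : Matrix (Fin n) (Fin n) ℝ}

lemma qform_smul (r : ℝ) (x : Fin n → ℝ) : qform H (r • x) = r ^ 2 * qform H x := by
  simp [qform, mulVec_smul, dotProduct_smul, smul_dotProduct]
  ring

lemma qform_nonneg (hH : H.PosSemidef) (x : Fin n → ℝ) : 0 ≤ qform H x := by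
  simpa [qform] using hH.dotProduct_mulVec_nonneg x

lemma dotProduct_mulVec_symm (hH : H.PosSemidef) (x y : Fin n → ℝ) :
    x ⬝ᵥ (H *ᵥ y) = y ⬝ᵥ (H *ᵥ x) := by
  have hT : H.IsSymm := by simpa using hH.isHermitian
  rw [dotProduct_mulVec, ← mulVec_transpose, hT.eq, dotProduct_comm]

lemma qform_add (hH : H.PosSemidef) (x y : Fin n → ℝ) :
    qform H (x + y) = qform H x + 2 * (x ⬝ᵥ (H *ᵥ y)) + qform H y := by
  simp only [qform, mulVec_add, add_dotProduct, dotProduct_add]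
  rw [dotProduct_mulVec_symm hH y x]
  ring

lemma qform_sub (hH : H.PosSemidef) (x y : Fin n → ℝ) :
    qform H (x - y) = qform H x - 2 * (x ⬝ᵥ (H *ᵥ y)) + qform H y := by
  simp only [qform, mulVec_sub, sub_dotProduct, dotProduct_sub]
  rw [dotProduct_mulVec_symm hH y x]
  ring

lemma qform_comb_le (hH : H.PosSemidef) (x y : Fin n → ℝ) {a b : ℝ} (ha : 0 ≤ a) (hb : 0 ≤ b)
    (hab : a + b = 1) : qform H (a • x + b • y) ≤ a * qform H x + b * qform H y := by
  have h1 := qform_nonneg hH (x - y)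
  rw [qform_sub hH] at h1
  rw [qform_add hH, qform_smul, qform_smul, mulVec_smul, dotProduct_smul, smul_dotProduct]
  obtain rfl : b = 1 - a := by linarith
  simp only [smul_eq_mul]
  nlinarith [mul_nonneg (mul_nonneg ha hb) h1]

lemma continuous_qform : Continuous (qform H) := by
  unfold qform; fun_prop

lemma contDiff_qform : ContDiff ℝ 1 (qform H) := by
  unfold qform
  simp only [dotProduct, mulVec]
  fun_prop

end QuadraticForm

/-- A positive function that is continuous and homogeneous of degree two is coercive. -/
lemma exists_coercive {E : Type*} [NormedAddCommGroup E] [NormedSpace ℝ E] [FiniteDimensional ℝ E]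
    {q : E → ℝ} (hq : Continuous q) (hhom : ∀ (r : ℝ) v, q (r • v) = r ^ 2 * q v)
    (hpos : ∀ v, v ≠ 0 → 0 < q v) : ∃ c > 0, ∀ v, c * ‖v‖ ^ 2 ≤ q v := by
  have hcomp : IsCompact (Metric.sphere (0 : E) 1) := isCompact_sphere 0 1
  have h0 : q 0 = 0 := by simpa using hhom 0 0
  rcases (Metric.sphere (0 : E) 1).eq_empty_or_nonempty with hne | hne
  · refine ⟨1, one_pos, fun v => ?_⟩
    have hv : v = 0 := by
      by_contra hv
      have : (‖v‖⁻¹ • v) ∈ Metric.sphere (0 : E) 1 := by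
        simp [norm_smul, inv_mul_cancel₀ (norm_ne_zero_iff.2 hv)]
      rw [hne] at this
      exact this
    simp [hv, h0]
  · obtain ⟨x, hx, hmin⟩ := hcomp.exists_isMinOn hne hq.continuousOn
    have hx0 : x ≠ 0 := by rintro rfl; simp at hx
    refine ⟨q x, hpos x hx0, fun v => ?_⟩
    by_cases hv : v = 0
    · simp [hv, h0]
    have hv' : ‖v‖ ≠ 0 := norm_ne_zero_iff.2 hv
    have hmem : (‖v‖⁻¹ • v) ∈ Metric.sphere (0 : E) 1 := by
      simp [norm_smul, inv_mul_cancel₀ hv']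
    have h1 : q x ≤ q (‖v‖⁻¹ • v) := hmin hmem
    rw [hhom, inv_pow, ← div_eq_inv_mul, le_div_iff₀ (by positivity)] at h1
    exact h1

section Loss

variable (H : Matrix (Fin n) (Fin n) ℝ) (M : Fin K → Matrix (Fin n) (Fin n) ℝ)

/-- The quadratic loss of the decoder with parameter `θ` over a window. -/
def quadLoss (z : Window n p K) (θ : Param n p) : ℝ := qform H (resid M z θ)

variable {H M}

lemma quadLoss_add (hH : H.PosSemidef) (z : Window n p K) (θ v : Param n p) :
    quadLoss H M z (θ + v) =
      quadLoss H M z θ - 2 * (resid M z θ ⬝ᵥ (H *ᵥ pred M z v)) + qform H (pred M z v) := by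
  rw [quadLoss, resid_add, qform_sub hH, quadLoss]

lemma continuous_resid :
    Continuous fun q : Window n p K × Param n p => resid M q.1 q.2 := by
  refine continuous_pi fun i => ?_
  simp only [resid, Finset.sum_apply, mulVec, dotProduct, Pi.sub_apply, decoder_apply]
  fun_prop

lemma continuous_quadLoss :
    Continuous fun q : Window n p K × Param n p => quadLoss H M q.1 q.2 :=
  continuous_qform.comp continuous_resid

lemma differentiable_quadLoss (z : Window n p K) : Differentiable ℝ (quadLoss H M z) := by
  refine (contDiff_qform.differentiable one_ne_zero).comp ?_
  refine differentiable_pi.2 fun i => ?_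
  simp only [resid, Finset.sum_apply, mulVec, dotProduct, Pi.sub_apply, decoder_apply]
  fun_prop

/-- Along a line the loss is a polynomial of degree two, so the directional derivative is its linear
coefficient. -/
lemma inner_gradient_quadLoss (hH : H.PosSemidef) (z : Window n p K) (θ v : Param n p) :
    inner ℝ (gradient (quadLoss H M z) θ) v = -2 * (resid M z θ ⬝ᵥ (H *ᵥ pred M z v)) := by
  have hdiff := (differentiable_quadLoss (H := H) (M := M) z) θ
  have h1 : HasDerivAt (fun t : ℝ => quadLoss H M z (θ + t • v))
      (inner ℝ (gradient (quadLoss H M z) θ) v) 0 := by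
    have hg := hdiff.hasGradientAt.hasFDerivAt
    have hline : HasDerivAt (fun t : ℝ => θ + t • v) v 0 := by
      simpa using ((hasDerivAt_id (0 : ℝ)).smul_const v).const_add θ
    have hg' : HasFDerivAt (quadLoss H M z)
      ((InnerProductSpace.toDual ℝ (Param n p)) (gradient (quadLoss H M z) θ))
      (θ + (0 : ℝ) • v) := by simpa using hg
    simpa [Function.comp_def] using hg'.comp_hasDerivAt (0 : ℝ) hline
  have h2 : HasDerivAt (fun t : ℝ => quadLoss H M z (θ + t • v))
      (-2 * (resid M z θ ⬝ᵥ (H *ᵥ pred M z v))) 0 := by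
    have hfun : (fun t : ℝ => quadLoss H M z (θ + t • v)) = fun t =>
        quadLoss H M z θ + t * (-2 * (resid M z θ ⬝ᵥ (H *ᵥ pred M z v)))
          + t ^ 2 * qform H (pred M z v) := by
      funext t
      rw [quadLoss_add hH, pred_smul, qform_smul, mulVec_smul, dotProduct_smul, smul_eq_mul]
      ring
    rw [hfun]
    have := (((hasDerivAt_id (0 : ℝ)).mul_const
      (-2 * (resid M z θ ⬝ᵥ (H *ᵥ pred M z v)))).const_add (quadLoss H M z θ)).add
      (((hasDerivAt_id (0 : ℝ)).pow 2).mul_const (qform H (pred M z v)))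
    exact (this.congr_deriv (by simp)).congr_of_eventuallyEq (Eventually.of_forall fun t => by simp)
  exact h1.unique h2

/-- The gradient of the quadratic loss is given by exact central differences. -/
lemma gradient_quadLoss_apply (hH : H.PosSemidef) (z : Window n p K) (θ : Param n p)
    (a : (Fin n × Fin p) ⊕ Fin n) :
    gradient (quadLoss H M z) θ a =
      (quadLoss H M z (θ + EuclideanSpace.single a 1)
        - quadLoss H M z (θ + (-1 : ℝ) • EuclideanSpace.single a 1)) / 2 := by
  have h := inner_gradient_quadLoss (M := M) hH z θ (EuclideanSpace.single a 1)
  rw [EuclideanSpace.inner_single_right] at h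
  rw [quadLoss_add hH, quadLoss_add hH, pred_smul, qform_smul, mulVec_smul, dotProduct_smul,
    smul_eq_mul]
  simp only [one_mul, conj_trivial] at h
  rw [h]
  ring

/-- Central differences reduce the claim to joint continuity of the loss itself. Its use is the
measurability of the iterates, where data and parameter both vary. -/
lemma continuous_gradient_quadLoss (hH : H.PosSemidef) :
    Continuous fun q : Window n p K × Param n p => gradient (quadLoss H M q.1) q.2 := by
  have hshift : ∀ e : Param n p,
      Continuous fun q : Window n p K × Param n p => quadLoss H M q.1 (q.2 + e) := fun e =>
    Continuous.comp (g := fun q : Window n p K × Param n p => quadLoss H M q.1 q.2)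
      (f := fun q : Window n p K × Param n p => (q.1, q.2 + e)) continuous_quadLoss (by fun_prop)
  have hgrad : (fun q : Window n p K × Param n p => gradient (quadLoss H M q.1) q.2) =
      fun q => WithLp.toLp 2 fun a => (quadLoss H M q.1 (q.2 + EuclideanSpace.single a 1)
        - quadLoss H M q.1 (q.2 + (-1 : ℝ) • EuclideanSpace.single a 1)) / 2 := by
    funext q
    ext a
    exact gradient_quadLoss_apply hH q.1 q.2 a
  rw [hgrad]
  exact (PiLp.continuous_toLp 2 _).comp
    (continuous_pi fun a => ((hshift _).sub (hshift _)).div_const 2)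

/-- Convexity of the loss. -/
lemma quadLoss_sub_le_inner_gradient (hH : H.PosSemidef) (z : Window n p K) (θ θs : Param n p) :
    quadLoss H M z θ - quadLoss H M z θs ≤ inner ℝ (gradient (quadLoss H M z) θ) (θ - θs) := by
  have h := quadLoss_add (M := M) hH z θ (-1 • (θ - θs))
  have h1 : θ + -1 • (θ - θs) = θs := by
    rw [neg_one_smul]; abel
  have h2 := inner_gradient_quadLoss (M := M) hH z θ (-1 • (θ - θs))
  rw [neg_one_smul, inner_neg_right, ← neg_one_smul ℤ (θ - θs)] at h2
  rw [h1] at h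
  have := qform_nonneg hH (pred M z (-1 • (θ - θs)))
  linarith

/-- On a convex set with bounded gradients, the loss is Lipschitz. -/
lemma abs_quadLoss_sub_le {Θ : Set (Param n p)} (hΘ : Convex ℝ Θ) {G : ℝ} {z : Window n p K}
    (hG : ∀ θ ∈ Θ, ‖gradient (quadLoss H M z) θ‖ ≤ G) {θ θs : Param n p} (hθ : θ ∈ Θ)
    (hθs : θs ∈ Θ) : |quadLoss H M z θ - quadLoss H M z θs| ≤ G * ‖θ - θs‖ := by
  refine hΘ.norm_image_sub_le_of_norm_fderiv_le (𝕜 := ℝ)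
    (fun x _ => differentiable_quadLoss z x) (fun x hx => ?_) hθs hθ
  have := hG x hx
  rwa [gradient, LinearIsometryEquiv.norm_map] at this

end Loss

/-! ### The expected loss: orthogonality, minimizer and quadratic growth. -/

variable {n m p K : ℕ} {Ω : Type*} [MeasurableSpace Ω] {μ : Measure Ω}

/-- Orthogonality of two random variables. -/
def Orth (μ : Measure Ω) (f g : Ω → ℝ) : Prop :=
  Integrable (fun ω => f ω * g ω) μ ∧ ∫ ω, f ω * g ω ∂μ = 0

lemma Orth.symm {f g : Ω → ℝ} (h : Orth μ f g) : Orth μ g f := by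
  simpa only [Orth, mul_comm] using h

lemma Orth.const_mul_left {f g : Ω → ℝ} (h : Orth μ f g) (c : ℝ) :
    Orth μ (fun ω => c * f ω) g := by
  constructor
  · simpa only [mul_assoc] using h.1.const_mul c
  · simp only [mul_assoc, integral_const_mul, h.2, mul_zero]

lemma Orth.add_left {f f' g : Ω → ℝ} (h : Orth μ f g) (h' : Orth μ f' g) :
    Orth μ (fun ω => f ω + f' ω) g := by
  constructor
  · simp only [add_mul]
    exact h.1.add h'.1
  · simp only [add_mul]
    rw [integral_add h.1 h'.1, h.2, h'.2, add_zero]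

lemma Orth.sum_left {ι : Type*} {s : Finset ι} {f : ι → Ω → ℝ} {g : Ω → ℝ}
    (h : ∀ i, Orth μ (f i) g) : Orth μ (fun ω => ∑ i ∈ s, f i ω) g := by
  constructor
  · simpa only [Finset.sum_mul] using integrable_finsetSum s fun i _ => (h i).1
  · simp only [Finset.sum_mul]
    rw [integral_finsetSum s fun i _ => (h i).1]
    exact Finset.sum_eq_zero fun i _ => (h i).2

/-- The parameter `[0, b]`. -/
def constParam (p : ℕ) (b : Fin n → ℝ) : Param n p := WithLp.toLp 2 (Sum.elim (fun _ => 0) b)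

lemma decoder_constParam (b : Fin n → ℝ) (d : Fin p → ℝ) : decoder (constParam p b) d = b := by
  ext i
  simp [decoder_apply, constParam]

lemma integrable_dotProduct_mulVec {H : Matrix (Fin n) (Fin n) ℝ} {f g : Ω → Fin n → ℝ}
    (hf : ∀ i, MemLp (fun ω => f ω i) 2 μ)
    (hg : ∀ i, MemLp (fun ω => g ω i) 2 μ) : Integrable (fun ω => f ω ⬝ᵥ (H *ᵥ g ω)) μ := by
  simp only [dotProduct, mulVec]
  refine integrable_finsetSum _ fun i _ => ?_
  exact (hf i).integrable_mul (memLp_finsetSum _ fun l _ => (hg l).const_mul _)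

section Moments

variable [IsProbabilityMeasure μ] {H : Matrix (Fin n) (Fin n) ℝ}
  {M : Fin K → Matrix (Fin n) (Fin n) ℝ} {Z : Ω → Window n p K}

lemma memLp_decoder (hd : ∀ j a, MemLp (fun ω => (Z ω j).1 a) 2 μ) (v : Param n p) (j : Fin K)
    (i : Fin n) : MemLp (fun ω => decoder v (Z ω j).1 i) 2 μ := by
  simp only [decoder_apply]
  exact (memLp_finsetSum _ fun a _ => (hd j a).const_mul _).add (memLp_const _)

lemma memLp_pred (hd : ∀ j a, MemLp (fun ω => (Z ω j).1 a) 2 μ) (v : Param n p) (i : Fin n) :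
    MemLp (fun ω => pred M (Z ω) v i) 2 μ := by
  simp only [pred, Finset.sum_apply, mulVec, dotProduct]
  exact memLp_finsetSum _ fun j _ => memLp_finsetSum _ fun a _ =>
    (memLp_decoder hd v j a).const_mul _

lemma memLp_resid (hd : ∀ j a, MemLp (fun ω => (Z ω j).1 a) 2 μ)
    (hw : ∀ j i, MemLp (fun ω => (Z ω j).2 i) 2 μ) (θ : Param n p) (i : Fin n) :
    MemLp (fun ω => resid M (Z ω) θ i) 2 μ := by
  simp only [resid, Finset.sum_apply, mulVec, dotProduct, Pi.sub_apply]
  exact memLp_finsetSum _ fun j _ => memLp_finsetSum _ fun a _ =>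
    ((hw j a).sub (memLp_decoder hd θ j a)).const_mul _

lemma integrable_quadLoss (hd : ∀ j a, MemLp (fun ω => (Z ω j).1 a) 2 μ)
    (hw : ∀ j i, MemLp (fun ω => (Z ω j).2 i) 2 μ) (θ : Param n p) :
    Integrable (fun ω => quadLoss H M (Z ω) θ) μ :=
  integrable_dotProduct_mulVec (memLp_resid hd hw θ) (memLp_resid hd hw θ)

/-- At `[0, b]` the residual combines centred disturbances, while a prediction combines embeddings
and constants; bilinearity reduces everything to `hmean` and `horth`. -/
lemma orth_resid_pred (hd : ∀ j a, MemLp (fun ω => (Z ω j).1 a) 2 μ)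
    (hw : ∀ j i, MemLp (fun ω => (Z ω j).2 i) 2 μ) {b : Fin n → ℝ}
    (hmean : ∀ j i, ∫ ω, (Z ω j).2 i ∂μ = b i)
    (horth : ∀ j j' i a, ∫ ω, ((Z ω j).2 i - b i) * (Z ω j').1 a ∂μ = 0) (v : Param n p)
    (i l : Fin n) :
    Orth μ (fun ω => resid M (Z ω) (constParam p b) i) (fun ω => pred M (Z ω) v l) := by
  have hcent : ∀ j i, MemLp (fun ω => (Z ω j).2 i - b i) 2 μ := fun j i =>
    (hw j i).sub (memLp_const _)
  have hone : ∀ j i, Orth μ (fun _ => 1) (fun ω => (Z ω j).2 i - b i) := by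
    intro j i
    have hi : Integrable (fun ω => (Z ω j).2 i) μ := (hw j i).integrable one_le_two
    constructor
    · simp only [one_mul]
      exact hi.sub (integrable_const (b i))
    · simp only [one_mul]
      rw [integral_sub hi (integrable_const _), hmean]
      simp
  have hdec : ∀ j j' i l, Orth μ (fun ω => decoder v (Z ω j').1 l)
      (fun ω => (Z ω j).2 i - b i) := by
    intro j j' i l
    simp only [decoder_apply]
    refine Orth.add_left (Orth.sum_left fun a => Orth.const_mul_left (Orth.symm ?_) _) ?_
    · exact ⟨(hcent j i).integrable_mul (hd j' a), horth j j' i a⟩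
    · simpa using (hone j i).const_mul_left (v (Sum.inr l))
  simp only [resid, pred, decoder_constParam, Finset.sum_apply, mulVec, dotProduct, Pi.sub_apply]
  refine Orth.sum_left fun j => Orth.sum_left fun a => Orth.const_mul_left (Orth.symm ?_) _
  exact Orth.sum_left fun j' => Orth.sum_left fun a' => (hdec j j' a a').const_mul_left _

/-- The expected loss is the sum of its value at `[0, E w]` and a quadratic form. -/
lemma integral_quadLoss_constParam_add (hH : H.PosSemidef)
    (hd : ∀ j a, MemLp (fun ω => (Z ω j).1 a) 2 μ)
    (hw : ∀ j i, MemLp (fun ω => (Z ω j).2 i) 2 μ) {b : Fin n → ℝ}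
    (hmean : ∀ j i, ∫ ω, (Z ω j).2 i ∂μ = b i)
    (horth : ∀ j j' i a, ∫ ω, ((Z ω j).2 i - b i) * (Z ω j').1 a ∂μ = 0) (v : Param n p) :
    ∫ ω, quadLoss H M (Z ω) (constParam p b + v) ∂μ =
      ∫ ω, quadLoss H M (Z ω) (constParam p b) ∂μ + ∫ ω, qform H (pred M (Z ω) v) ∂μ := by
  have h0 : Orth μ (fun ω => resid M (Z ω) (constParam p b) ⬝ᵥ (H *ᵥ pred M (Z ω) v))
      (fun _ => 1) := by
    have hpair : ∀ i l, Orth μ (fun ω => resid M (Z ω) (constParam p b) i * pred M (Z ω) v l)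
        (fun _ => 1) := fun i l => by
      simpa [Orth] using orth_resid_pred (M := M) hd hw hmean horth v i l
    simp only [dotProduct, mulVec, Finset.mul_sum]
    refine Orth.sum_left fun i => Orth.sum_left fun l => ?_
    simpa only [mul_left_comm] using (hpair i l).const_mul_left (H i l)
  simp only [Orth, mul_one] at h0
  have i1 := integrable_quadLoss (H := H) (M := M) hd hw (constParam p b)
  have i3 : Integrable (fun ω => qform H (pred M (Z ω) v)) μ :=
    integrable_dotProduct_mulVec (memLp_pred hd v) (memLp_pred hd v)
  have i2 := h0.1.const_mul 2
  have i12 : Integrable (fun ω => quadLoss H M (Z ω) (constParam p b)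
      - 2 * (resid M (Z ω) (constParam p b) ⬝ᵥ (H *ᵥ pred M (Z ω) v))) μ := i1.sub i2
  simp only [quadLoss_add hH]
  rw [integral_add i12 i3, integral_sub i1 i2, integral_const_mul, h0.2]
  ring

/-- If the expected loss has a unique minimizer, then this is `[0, E w]`, and the expected loss
grows quadratically around it. -/
lemma eq_constParam_of_unique_minimizer (hH : H.PosSemidef)
    (hd : ∀ j a, MemLp (fun ω => (Z ω j).1 a) 2 μ)
    (hw : ∀ j i, MemLp (fun ω => (Z ω j).2 i) 2 μ) {b : Fin n → ℝ}
    (hmean : ∀ j i, ∫ ω, (Z ω j).2 i ∂μ = b i)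
    (horth : ∀ j j' i a, ∫ ω, ((Z ω j).2 i - b i) * (Z ω j').1 a ∂μ = 0) {θs : Param n p}
    (hmin : ∀ θ, θ ≠ θs →
      ∫ ω, quadLoss H M (Z ω) θs ∂μ < ∫ ω, quadLoss H M (Z ω) θ ∂μ) :
    θs = constParam p b ∧ ∃ c > 0, ∀ θ, c * ‖θ - constParam p b‖ ^ 2 ≤
      ∫ ω, quadLoss H M (Z ω) θ ∂μ - ∫ ω, quadLoss H M (Z ω) (constParam p b) ∂μ := by
  have hJ := integral_quadLoss_constParam_add (M := M) hH hd hw hmean horth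
  set q : Param n p → ℝ := fun v => ∫ ω, qform H (pred M (Z ω) v) ∂μ with hq
  have hint : ∀ v : Param n p, Integrable (fun ω => qform H (pred M (Z ω) v)) μ := fun v =>
    integrable_dotProduct_mulVec (memLp_pred hd v) (memLp_pred hd v)
  have hq0 : ∀ v, 0 ≤ q v := fun v => integral_nonneg fun ω => qform_nonneg hH _
  have hθs : θs = constParam p b := by
    by_contra hne
    have h1 := hmin _ (Ne.symm hne)
    have h2 := hJ (θs - constParam p b)
    rw [add_sub_cancel] at h2
    linarith [hq0 (θs - constParam p b)]
  refine ⟨hθs, ?_⟩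
  -- A finite convex function on a finite-dimensional space is continuous, so no limit has to be
  -- taken under the integral.
  have hcont : Continuous q := by
    rw [← continuousOn_univ]
    refine ConvexOn.continuousOn isOpen_univ ⟨convex_univ, fun u _ v _ a a' ha ha' haa => ?_⟩
    rw [smul_eq_mul, smul_eq_mul, hq, ← integral_const_mul, ← integral_const_mul,
      ← integral_add ((hint u).const_mul a) ((hint v).const_mul a')]
    refine integral_mono (hint _) (((hint u).const_mul a).add ((hint v).const_mul a')) fun ω => ?_
    simp only [pred_add, pred_smul]
    exact qform_comb_le hH _ _ ha ha' haa
  obtain ⟨c, hc, hcq⟩ := exists_coercive hcont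
    (fun r v => by simp only [hq, pred_smul, qform_smul, integral_const_mul])
    (fun v hv => by
      have h1 := hmin (constParam p b + v) (by simpa [hθs] using hv)
      rw [hJ v, hθs] at h1
      linarith)
  refine ⟨c, hc, fun θ => ?_⟩
  have h2 := hJ (θ - constParam p b)
  rw [add_sub_cancel] at h2
  linarith [hcq (θ - constParam p b)]

end Moments

lemma measurable_quadLoss {H : Matrix (Fin n) (Fin n) ℝ} {M : Fin K → Matrix (Fin n) (Fin n) ℝ}
    {f : Ω → Window n p K} {g : Ω → Param n p} (hf : Measurable f) (hg : Measurable g) :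
    Measurable fun ω => quadLoss H M (f ω) (g ω) :=
  Measurable.comp (g := fun q : Window n p K × Param n p => quadLoss H M q.1 q.2)
    (f := fun ω => (f ω, g ω)) continuous_quadLoss.measurable (hf.prodMk hg)

/-- If the expected loss over a window of length one has a unique minimizer, then the embeddings
are square integrable. -/
lemma memLp_embedding_of_unique_minimizer [IsProbabilityMeasure μ] {H : Matrix (Fin n) (Fin n) ℝ}
    {M : Fin 1 → Matrix (Fin n) (Fin n) ℝ} {Z : Ω → Window n p 1} (hH : H.PosSemidef) (i : Fin n)
    (hZ : Measurable Z) (hw : ∀ i, MemLp (fun ω => (Z ω 0).2 i) 2 μ) {θs : Param n p}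
    (hmin : ∀ θ, θ ≠ θs →
      ∫ ω, quadLoss H M (Z ω) θs ∂μ < ∫ ω, quadLoss H M (Z ω) θ ∂μ) (a : Fin p) :
    MemLp (fun ω => (Z ω 0).1 a) 2 μ := by
  have hnonneg : ∀ θ : Param n p, 0 ≤ ∫ ω, quadLoss H M (Z ω) θ ∂μ := fun θ =>
    integral_nonneg fun ω => qform_nonneg hH _
  -- If the form vanished at some `v ≠ 0`, adding `v` to the offset would leave the loss unchanged
  -- for every outcome and produce a second minimizer.
  obtain ⟨c, hc, hcq⟩ : ∃ c > 0, ∀ v : Fin n → ℝ, c * ‖v‖ ^ 2 ≤ qform H (M 0 *ᵥ v) := by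
    refine exists_coercive (q := fun v => qform H (M 0 *ᵥ v))
      (continuous_qform.comp (by fun_prop)) (fun r v => ?_) (fun v hv => ?_)
    · simp only [mulVec_smul, qform_smul]
    · refine lt_of_le_of_ne (qform_nonneg hH _) fun h0 => ?_
      have hzero : H *ᵥ (M 0 *ᵥ v) = 0 := by
        refine (hH.dotProduct_mulVec_zero_iff _).1 ?_
        simpa [qform] using h0.symm
      have hpred : ∀ z : Window n p 1, pred M z (constParam p v) = M 0 *ᵥ v := fun z => by
        simp [pred, decoder_constParam]
      have hne : θs + constParam p v ≠ θs := by
        intro h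
        apply hv
        have h1 : constParam p v = 0 := by simpa using h
        have h2 := decoder_constParam v (0 : Fin p → ℝ)
        rw [h1] at h2
        rw [← h2]
        ext l
        simp [decoder_apply]
      refine (hmin _ hne).ne ?_
      refine integral_congr_ae (ae_of_all _ fun ω => ?_)
      simp only [quadLoss_add hH, hpred, hzero, dotProduct_zero, ← h0]
      ring
  set e : (Fin n × Fin p) ⊕ Fin n := Sum.inl (i, a) with he
  -- This value makes `θ` differ from `θs` in the coordinate `e` and is nonzero, so that it can be
  -- divided out at the end.
  set r : ℝ := |θs e| + 1 with hr
  have hr0 : r ≠ 0 := by positivity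
  set θ : Param n p := EuclideanSpace.single e r with hθ
  have hne : θ ≠ θs := by
    intro h
    have h1 : θ e = r := by simp [hθ]
    rw [h] at h1
    linarith [le_abs_self (θs e)]
  -- The integral of a non-integrable function is `0` by convention, and `0` cannot strictly exceed
  -- the nonnegative integral at `θs`.
  have hint : Integrable (fun ω => quadLoss H M (Z ω) θ) μ := by
    by_contra h
    have h1 := hmin θ hne
    rw [integral_undef h] at h1
    linarith [hnonneg θs]
  have hdec : ∀ d : Fin p → ℝ, decoder θ d i = r * d a := by
    intro d
    rw [decoder_apply, Finset.sum_eq_single a]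
    · simp [hθ, he]
    · intro a' _ ha'
      simp [hθ, he, ha']
    · simp
  have hmeas : ∀ a, Measurable fun ω => (Z ω 0).1 a := fun a =>
    (measurable_pi_apply a).comp (measurable_fst.comp ((measurable_pi_apply 0).comp hZ))
  have hmeas' : ∀ a, Measurable fun ω => (Z ω 0).2 a := fun a =>
    (measurable_pi_apply a).comp (measurable_snd.comp ((measurable_pi_apply 0).comp hZ))
  have hL2 : MemLp (fun ω => (Z ω 0).2 i - r * (Z ω 0).1 a) 2 μ := by
    have hms := ((hmeas' i).sub ((hmeas a).const_mul r)).aestronglyMeasurable (μ := μ)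
    refine (memLp_two_iff_integrable_sq hms).2 ?_
    refine (hint.const_mul c⁻¹).mono' (hms.pow 2) (ae_of_all _ fun ω => ?_)
    have h1 := hcq ((Z ω 0).2 - decoder θ (Z ω 0).1)
    have h2 := norm_le_pi_norm ((Z ω 0).2 - decoder θ (Z ω 0).1) i
    rw [Pi.sub_apply, hdec, Real.norm_eq_abs] at h2
    have h3 : quadLoss H M (Z ω) θ = qform H (M 0 *ᵥ ((Z ω 0).2 - decoder θ (Z ω 0).1)) := by
      simp [quadLoss, resid]
    rw [norm_pow, Real.norm_eq_abs, h3, ← div_eq_inv_mul, le_div_iff₀ hc, mul_comm]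
    refine le_trans ?_ h1
    gcongr
    exact h2
  have := ((hw i).sub hL2).const_mul r⁻¹
  refine this.ae_eq (ae_of_all _ fun ω => ?_)
  simp only [Pi.sub_apply]
  field_simp
  ring

/-- Expectation of a function of two independent random elements, by conditioning on the first. -/
lemma le_integral_of_indepFun {α β : Type*} [MeasurableSpace α] [MeasurableSpace β]
    [IsProbabilityMeasure μ] {X : Ω → α} {Z : Ω → β} (hX : Measurable X) (hZ : Measurable Z)
    (hXZ : IndepFun X Z μ) {f : α × β → ℝ} (hf : Measurable f)
    (hint : Integrable (fun ω => f (X ω, Z ω)) μ) {g : α → ℝ} (hg : Measurable g)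
    (hgint : Integrable (fun ω => g (X ω)) μ) (hle : ∀ a, g a ≤ ∫ ω, f (a, Z ω) ∂μ) :
    ∫ ω, g (X ω) ∂μ ≤ ∫ ω, f (X ω, Z ω) ∂μ := by
  have hpair : Measurable fun ω => (X ω, Z ω) := hX.prodMk hZ
  have hlaw := (indepFun_iff_map_prod_eq_prod_map_map hX.aemeasurable hZ.aemeasurable).1 hXZ
  have := Measure.isProbabilityMeasure_map (μ := μ) hX.aemeasurable
  have := Measure.isProbabilityMeasure_map (μ := μ) hZ.aemeasurable
  have hint' : Integrable f ((μ.map X).prod (μ.map Z)) := by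
    rw [← hlaw, integrable_map_measure hf.aestronglyMeasurable hpair.aemeasurable]
    exact hint
  have h1 : ∫ ω, f (X ω, Z ω) ∂μ = ∫ a, ∫ b, f (a, b) ∂(μ.map Z) ∂(μ.map X) := by
    rw [← integral_prod f hint', ← hlaw,
      integral_map hpair.aemeasurable hf.aestronglyMeasurable]
  rw [h1, ← integral_map hX.aemeasurable hg.aestronglyMeasurable]
  refine integral_mono ?_ hint'.integral_prod_left fun a => ?_
  · exact (integrable_map_measure hg.aestronglyMeasurable hX.aemeasurable).2 hgint
  · refine (hle a).trans (le_of_eq ?_)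
    exact (integral_map hZ.aemeasurable
      (hf.comp measurable_prodMk_left).aestronglyMeasurable).symm

/-! ### Euclidean projection onto a convex set. -/

lemma isProj_self {E : Type*} [PseudoMetricSpace E] {Θ : Set E} {z : E} (hz : z ∈ Θ) :
    IsProj Θ z z :=
  ⟨hz, fun w _ => by rw [dist_self]; exact dist_nonneg⟩

section Projection

variable {E : Type*} [NormedAddCommGroup E] [InnerProductSpace ℝ E] {Θ : Set E}

lemma IsProj.inner_le_zero (hΘ : Convex ℝ Θ) {x y : E} (h : IsProj Θ x y) {z : E} (hz : z ∈ Θ) :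
    inner ℝ (x - y) (z - y) ≤ 0 := by
  refine (norm_eq_iInf_iff_real_inner_le_zero hΘ h.1).1 ?_ z hz
  have : Nonempty Θ := ⟨⟨y, h.1⟩⟩
  refine le_antisymm (le_ciInf fun w => ?_) ?_
  · simpa only [dist_eq_norm] using h.2 w w.2
  · exact ciInf_le ⟨0, by rintro _ ⟨w, rfl⟩; exact norm_nonneg _⟩ (⟨y, h.1⟩ : Θ)

/-- The projection onto a convex set is nonexpansive. -/
lemma IsProj.dist_le (hΘ : Convex ℝ Θ) {x y x' y' : E} (h : IsProj Θ x y) (h' : IsProj Θ x' y') :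
    dist y y' ≤ dist x x' := by
  have h1 := h.inner_le_zero hΘ h'.1
  have h2 := h'.inner_le_zero hΘ h.1
  rw [dist_eq_norm, dist_eq_norm]
  -- The sum of the two variational inequalities, each tested at the other projection.
  have h3 : ‖y - y'‖ ^ 2 ≤ inner ℝ (x - x') (y - y') := by
    have e1 : inner ℝ (x - y) (y' - y) = -inner ℝ (x - y) (y - y') := by
      rw [← inner_neg_right, neg_sub]
    have e2 : x - x' = (x - y) - (x' - y') + (y - y') := by abel
    rw [e2, inner_add_left, inner_sub_left, real_inner_self_eq_norm_sq]
    linarith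
  have h4 := real_inner_le_norm (x - x') (y - y')
  by_contra hlt
  push Not at hlt
  nlinarith [norm_nonneg (x - x'), norm_nonneg (y - y')]

lemma IsProj.eq (hΘ : Convex ℝ Θ) {x y y' : E} (h : IsProj Θ x y) (h' : IsProj Θ x y') :
    y = y' := by
  simpa using h.dist_le hΘ h'

/-- The projection onto a closed convex set is a continuous map. -/
lemma exists_continuous_proj [FiniteDimensional ℝ E] (hΘ : Convex ℝ Θ) (hcl : IsClosed Θ)
    (hne : Θ.Nonempty) : ∃ π : E → E, Continuous π ∧ ∀ x y, IsProj Θ x y → y = π x := by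
  have : ProperSpace E := FiniteDimensional.proper_real E
  have hex : ∀ x, ∃ y, IsProj Θ x y := fun x => by
    obtain ⟨y, hy, hxy⟩ := hcl.exists_infDist_eq_dist hne x
    exact ⟨y, hy, fun z hz => hxy ▸ Metric.infDist_le_dist_of_mem hz⟩
  choose π hπ using hex
  refine ⟨π, ?_, fun x y h => h.eq hΘ (hπ x)⟩
  have : LipschitzWith 1 π := LipschitzWith.of_dist_le_mul fun x x' => by
    simpa using (hπ x).dist_le hΘ (hπ x')
  exact this.continuous

end Projection

/-! ### Windows of the random data: independence and common law. -/

variable {n m p : ℕ}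

lemma posSemidef_matH {B : Matrix (Fin n) (Fin m) ℝ} {R : Matrix (Fin m) (Fin m) ℝ}
    {P : Matrix (Fin n) (Fin n) ℝ} (hR : R.PosDef) (hP : P.PosSemidef) :
    (matH B R P).PosSemidef := by
  have h1 : (Bᵀ * P * B).PosSemidef := by
    simpa [conjTranspose_eq_transpose_of_trivial] using hP.conjTranspose_mul_mul_same B
  have h2 := (hR.add_posSemidef h1).inv.posSemidef
  simpa [matH, conjTranspose_eq_transpose_of_trivial] using h2.mul_mul_conjTranspose_same B

/-- The weights of the prediction errors over a window of length `K`. -/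
noncomputable def weights (A : Matrix (Fin n) (Fin n) ℝ) (B : Matrix (Fin n) (Fin m) ℝ)
    (R : Matrix (Fin m) (Fin m) ℝ) (P : Matrix (Fin n) (Fin n) ℝ) (K : ℕ) :
    Fin K → Matrix (Fin n) (Fin n) ℝ := fun j => (matF A B R P)ᵀ ^ (j : ℕ) * P

/-- The data of the window of length `K` that starts at time `s`. -/
def window (K : ℕ) (d : ℕ → ℕ → Fin p → ℝ) (w : ℕ → Fin n → ℝ) (s : ℕ) : Window n p K :=
  fun j => (d (s + j) s, w (s + j))

/-- The substitution `τ = t + j`. Keeping the actual window length `K` free covers both full windows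
and the truncated one at horizon one. -/
lemma loss_eq_quadLoss (A : Matrix (Fin n) (Fin n) ℝ) (B : Matrix (Fin n) (Fin m) ℝ)
    (R : Matrix (Fin m) (Fin m) ℝ) (P : Matrix (Fin n) (Fin n) ℝ) {k T t K : ℕ}
    (hK : lastIdx k T t + 1 = t + K) (d : ℕ → ℕ → Fin p → ℝ) (w : ℕ → Fin n → ℝ) :
    loss A B R P k T d w t = quadLoss (matH B R P) (weights A B R P K) (window K d w t) := by
  funext θ
  have hpsi : psiHat A B R P k T d w t θ = resid (weights A B R P K) (window K d w t) θ := by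
    have hIcc : Finset.Icc t (lastIdx k T t) = Finset.Ico t (t + K) := by
      ext x; simp only [Finset.mem_Icc, Finset.mem_Ico]; omega
    rw [psiHat, hIcc, ← Finset.sum_sub_distrib, Finset.sum_Ico_eq_sum_range, Nat.add_sub_cancel_left,
      ← Fin.sum_univ_eq_sum_range (fun j => ((matF A B R P)ᵀ ^ (t + j - t) * P) *ᵥ w (t + j) -
        ((matF A B R P)ᵀ ^ (t + j - t) * P) *ᵥ decoder θ (d (t + j) t)) K]
    simp only [resid, weights, window, mulVec_sub, Nat.add_sub_cancel_left]
  rw [loss, hpsi, quadLoss, qform]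

lemma lastIdx_add_one {k T s : ℕ} (hk : 1 ≤ k) (h : s + k ≤ T) : lastIdx k T s + 1 = s + k := by
  unfold lastIdx; omega

section Data

variable {Ω : Type*} {d : ℕ → ℕ → Ω → Fin p → ℝ} {w : ℕ → Ω → Fin n → ℝ}

/-- The data of time `τ`: all the embeddings for this time, and the disturbance. -/
def datum (d : ℕ → ℕ → Ω → Fin p → ℝ) (w : ℕ → Ω → Fin n → ℝ) (τ : ℕ) (ω : Ω) :
    (Fin (τ + 1) → Fin p → ℝ) × (Fin n → ℝ) := ((fun t : Fin (τ + 1) => d τ t ω), w τ ω)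

/-- The window data as a random element. -/
def rwindow (K : ℕ) (d : ℕ → ℕ → Ω → Fin p → ℝ) (w : ℕ → Ω → Fin n → ℝ) (s : ℕ) (ω : Ω) :
    Window n p K := window K (fun τ t => d τ t ω) (fun τ => w τ ω) s

lemma measurable_rwindow_iSup (K s : ℕ) :
    Measurable[⨆ τ ∈ Set.Ico s (s + K), MeasurableSpace.comap (datum d w τ) inferInstance]
      (rwindow K d w s) := by
  refine @measurable_pi_lambda _ _ _ (_) _ _ fun j => ?_
  refine Measurable.comp (g := fun x : (Fin (s + j + 1) → Fin p → ℝ) × (Fin n → ℝ) =>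
    (x.1 ⟨s, by omega⟩, x.2)) (f := datum d w (s + j)) (by fun_prop) ?_
  refine (comap_measurable (datum d w (s + j))).mono ?_ le_rfl
  exact le_iSup₂_of_le (s + (j : ℕ)) ⟨by omega, by omega⟩ le_rfl

variable [MeasurableSpace Ω] {μ : Measure Ω}

lemma measurable_datum (hd : ∀ τ t, Measurable (d τ t)) (hw : ∀ τ, Measurable (w τ)) (τ : ℕ) :
    Measurable (datum d w τ) := by
  have h : Measurable fun ω => (fun t : Fin (τ + 1) => d τ t ω) :=
    measurable_pi_lambda _ fun t => hd τ t
  exact h.prodMk (hw τ)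

lemma measurable_rwindow (hd : ∀ τ t, Measurable (d τ t)) (hw : ∀ τ, Measurable (w τ)) (K s : ℕ) :
    Measurable (rwindow K d w s) :=
  measurable_pi_lambda _ fun j => (hd (s + j) s).prodMk (hw (s + j))

lemma iIndepFun_rwindow_apply (h_indep : iIndepFun (datum d w) μ) (K s : ℕ) :
    iIndepFun (fun (j : Fin K) ω => rwindow K d w s ω j) μ := by
  have h1 := h_indep.precomp (g := fun j : Fin K => s + (j : ℕ))
    (fun i j h => Fin.ext (by simpa using h))
  exact h1.comp (fun j x => (x.1 ⟨s, by omega⟩, x.2)) fun j => by fun_prop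

/-- The entries of a window belong to distinct times, so they are independent with a common law.
Hence quadratic growth of the expected loss is needed for the window at time `0` only. -/
lemma identDistrib_rwindow (h_indep : iIndepFun (datum d w) μ)
    (h_ident : ∀ τ t, t ≤ τ →
      IdentDistrib (fun ω => (d τ t ω, w τ ω)) (fun ω => (d 0 0 ω, w 0 ω)) μ μ) (K s : ℕ) :
    IdentDistrib (rwindow K d w s) (rwindow K d w 0) μ μ :=
  IdentDistrib.pi (fun j => (h_ident (s + j) s (by omega)).trans (h_ident (0 + j) 0 (by omega)).symm)
    (iIndepFun_rwindow_apply h_indep K s) (iIndepFun_rwindow_apply h_indep K 0)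

/-- Embeddings and centred disturbances are orthogonal within a window. -/
lemma integral_centred_mul_embedding [IsProbabilityMeasure μ] (h_indep : iIndepFun (datum d w) μ)
    (h_ident : ∀ τ t, t ≤ τ →
      IdentDistrib (fun ω => (d τ t ω, w τ ω)) (fun ω => (d 0 0 ω, w 0 ω)) μ μ)
    (h_uncorr : ∀ (j : Fin p) (i : Fin n), cov[fun ω => d 0 0 ω j, fun ω => w 0 ω i; μ] = 0)
    (hd : ∀ a, MemLp (fun ω => d 0 0 ω a) 2 μ) (hw : ∀ i, MemLp (fun ω => w 0 ω i) 2 μ)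
    (hd_meas : ∀ τ t, Measurable (d τ t)) (hw_meas : ∀ τ, Measurable (w τ))
    (K s : ℕ) (j j' : Fin K) (i : Fin n) (a : Fin p) :
    ∫ ω, ((rwindow K d w s ω j).2 i - ∫ ω', w 0 ω' i ∂μ) * (rwindow K d w s ω j').1 a ∂μ = 0 := by
  set b := ∫ ω', w 0 ω' i ∂μ with hb
  have hwint : Integrable (fun ω => w 0 ω i) μ := (hw i).integrable one_le_two
  have hdint : Integrable (fun ω => d 0 0 ω a) μ := (hd a).integrable one_le_two
  -- Equal times use the vanishing covariance, different times independence and the zero mean of the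
  -- centred disturbance.
  by_cases hjj : j = j'
  · subst hjj
    have h1 : IdentDistrib (fun ω => ((rwindow K d w s ω j).2 i - b) * (rwindow K d w s ω j).1 a)
        (fun ω => (w 0 ω i - b) * d 0 0 ω a) μ μ :=
      (h_ident (s + j) s (by omega)).comp
        (u := fun x : (Fin p → ℝ) × (Fin n → ℝ) => (x.2 i - b) * x.1 a) (by fun_prop)
    rw [h1.integral_eq]
    have h2 := h_uncorr a i
    rw [covariance_eq_sub (hd a) (hw i)] at h2
    have h3 : Integrable (fun ω => w 0 ω i * d 0 0 ω a) μ := (hw i).integrable_mul (hd a)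
    simp only [sub_mul]
    rw [integral_sub h3 (hdint.const_mul b), integral_const_mul]
    simp only [Pi.mul_apply, mul_comm] at h2 ⊢
    linarith
  · have h1 := (iIndepFun_rwindow_apply h_indep K s).indepFun hjj
    have h2 : IndepFun (fun ω => (rwindow K d w s ω j).2 i - b)
        (fun ω => (rwindow K d w s ω j').1 a) μ :=
      h1.comp (φ := fun x : (Fin p → ℝ) × (Fin n → ℝ) => x.2 i - b)
        (ψ := fun x : (Fin p → ℝ) × (Fin n → ℝ) => x.1 a) (by fun_prop) (by fun_prop)
    have hm := measurable_rwindow hd_meas hw_meas K s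
    have hm1 : ∀ j, Measurable fun ω => rwindow K d w s ω j := fun j =>
      (measurable_pi_apply j).comp hm
    have hmean : ∫ ω, ((rwindow K d w s ω j).2 i - b) ∂μ = 0 := by
      have h3 : IdentDistrib (fun ω => (rwindow K d w s ω j).2 i - b)
          (fun ω => w 0 ω i - b) μ μ :=
        (h_ident (s + j) s (by omega)).comp
          (u := fun x : (Fin p → ℝ) × (Fin n → ℝ) => x.2 i - b) (by fun_prop)
      rw [h3.integral_eq, integral_sub hwint (integrable_const _)]
      simp [hb]
    rw [h2.integral_fun_mul_eq_mul_integral, hmean, zero_mul]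
    · exact Measurable.aestronglyMeasurable (by have := hm1 j; fun_prop)
    · exact Measurable.aestronglyMeasurable (by have := hm1 j'; fun_prop)

end Data

/-! ### Runs of the algorithm: independence of the horizon and measurability with respect to the
past. -/

section Run

variable {n m p : ℕ} {A : Matrix (Fin n) (Fin n) ℝ} {B : Matrix (Fin n) (Fin m) ℝ}
  {R : Matrix (Fin m) (Fin m) ℝ} {P : Matrix (Fin n) (Fin n) ℝ} {k : ℕ} {Θ : Set (Param n p)}
  {η : ℕ → ℝ} {θ₀ : Param n p}

/-- The losses that are used in a run do not depend on the horizon. -/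
lemma IsRun.isProj_step {T : ℕ} (hk : 1 ≤ k) {d : ℕ → ℕ → Fin p → ℝ} {w : ℕ → Fin n → ℝ}
    {x : ℕ → Param n p} (h : IsRun k T Θ η θ₀ (loss A B R P k T d w) x) {t : ℕ} (ht : t < T) :
    IsProj Θ (x t - η t • (if t < k then 0 else
      gradient (quadLoss (matH B R P) (weights A B R P k) (window k d w (t + 1 - k)))
        (x (t + 1 - k)))) (x (t + 1)) := by
  have h1 := h.step t ht
  by_cases htk : t < k
  · simpa only [htk, if_true] using h1
  · simp only [htk, if_false] at h1 ⊢
    -- The window starting at `t + 1 - k` ends at `t ≤ T - 1`, so the horizon does not cut it.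
    rwa [loss_eq_quadLoss A B R P (lastIdx_add_one hk (by omega)) d w] at h1

/-- Runs with different horizons agree as long as both are defined. -/
lemma IsRun.eq_of_le {T T' : ℕ} (hk : 1 ≤ k) (hΘ : Convex ℝ Θ) {d : ℕ → ℕ → Fin p → ℝ}
    {w : ℕ → Fin n → ℝ} {x x' : ℕ → Param n p}
    (h : IsRun k T Θ η θ₀ (loss A B R P k T d w) x)
    (h' : IsRun k T' Θ η θ₀ (loss A B R P k T' d w) x') (t : ℕ) (ht : t ≤ T) (ht' : t ≤ T') :
    x t = x' t := by
  induction t using Nat.strong_induction_on with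
  | _ t ih =>
    rcases t with _ | t
    · rw [h.init, h'.init]
    · have h1 := h.isProj_step hk (t := t) (by omega)
      have h2 := h'.isProj_step hk (t := t) (by omega)
      rw [ih t (by omega) (by omega) (by omega)] at h1
      by_cases htk : t < k
      · simp only [htk, if_true] at h1 h2
        exact h1.eq hΘ h2
      · simp only [htk, if_false] at h1 h2
        rw [ih (t + 1 - k) (by omega) (by omega) (by omega)] at h1
        exact h1.eq hΘ h2

/-- The parameter at time `t` is a function of the data of the times before `t`. -/
lemma measurable_iterate {Ω : Type*} {d : ℕ → ℕ → Ω → Fin p → ℝ} {w : ℕ → Ω → Fin n → ℝ}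
    (hk : 1 ≤ k) (hΘ : Convex ℝ Θ) (hcl : IsClosed Θ) (hne : Θ.Nonempty)
    {H : Matrix (Fin n) (Fin n) ℝ} {M : Fin k → Matrix (Fin n) (Fin n) ℝ} (hH : H.PosSemidef)
    {x : ℕ → Ω → Param n p} (h0 : ∀ ω, x 0 ω = θ₀)
    (hstep : ∀ t ω, IsProj Θ (x t ω - η t • (if t < k then 0 else
      gradient (quadLoss H M (rwindow k d w (t + 1 - k) ω)) (x (t + 1 - k) ω))) (x (t + 1) ω))
    (t : ℕ) :
    Measurable[⨆ τ ∈ Set.Iio t, MeasurableSpace.comap (datum d w τ) inferInstance] (x t) := by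
  obtain ⟨π, hπ, hproj⟩ := exists_continuous_proj hΘ hcl hne
  have hmono : ∀ {s : Set ℕ} {u : ℕ}, s ⊆ Set.Iio u →
      (⨆ τ ∈ s, MeasurableSpace.comap (datum d w τ) inferInstance) ≤
        ⨆ τ ∈ Set.Iio u, MeasurableSpace.comap (datum d w τ) inferInstance :=
    fun hsu => biSup_mono fun i hi => hsu hi
  induction t using Nat.strong_induction_on with
  | _ t ih =>
    rcases t with _ | t
    · rw [show x 0 = fun _ => θ₀ from funext h0]
      exact measurable_const
    -- `IsProj` is only a relation; uniqueness of the nearest point turns the step into a continuous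
    -- function of earlier quantities, so measurability need not be assumed.
    · rw [show x (t + 1) = fun ω => π (x t ω - η t • (if t < k then 0 else
        gradient (quadLoss H M (rwindow k d w (t + 1 - k) ω)) (x (t + 1 - k) ω)))
        from funext fun ω => hproj _ _ (hstep t ω)]
      have hxt := (ih t (by omega)).mono (hmono (Set.Iio_subset_Iio (Nat.le_succ t))) le_rfl
      by_cases htk : t < k
      · simp only [htk, if_true, smul_zero, sub_zero]
        exact hπ.measurable.comp hxt
      · simp only [htk, if_false]
        have hxs := (ih (t + 1 - k) (by omega)).mono
          (hmono (u := t + 1) (Set.Iio_subset_Iio (by omega))) le_rfl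
        have hz := (measurable_rwindow_iSup (d := d) (w := w) k (t + 1 - k)).mono
          (hmono (u := t + 1) fun i hi => by
            simp only [Set.mem_Ico, Set.mem_Iio] at hi ⊢; omega) le_rfl
        have hg := (continuous_gradient_quadLoss (M := M) hH).measurable.comp (hz.prodMk hxs)
        exact hπ.measurable.comp (hxt.sub (hg.const_smul (η t)))

end Run

/-! ### Drift and convergence of the iteration. -/

section Convergence

variable {n p k : ℕ} {Θ : Set (Param n p)} {η : ℕ → ℝ} {θ₀ : Param n p}
  {Ω : Type*} [MeasurableSpace Ω] {μ : Measure Ω} [IsProbabilityMeasure μ]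
  {d : ℕ → ℕ → Ω → Fin p → ℝ} {w : ℕ → Ω → Fin n → ℝ}
  {H : Matrix (Fin n) (Fin n) ℝ} {M : Fin k → Matrix (Fin n) (Fin n) ℝ}

/-- Expected drift of the iteration, from independence of the iterate and the next window. -/
lemma le_integral_quadLoss_sub_mul {s : ℕ} {x : Ω → Param n p} {θs : Param n p} {c D G : ℝ}
    (h_indep : iIndepFun (datum d w) μ)
    (h_ident : ∀ τ t, t ≤ τ →
      IdentDistrib (fun ω => (d τ t ω, w τ ω)) (fun ω => (d 0 0 ω, w 0 ω)) μ μ)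
    (hd_meas : ∀ τ t, Measurable (d τ t)) (hw_meas : ∀ τ, Measurable (w τ))
    (hx : Measurable[⨆ τ ∈ Set.Iio s, MeasurableSpace.comap (datum d w τ) inferInstance] x)
    (hD : ∀ ω, ‖x ω - θs‖ ≤ D)
    (hG : ∀ᵐ ω ∂μ, |quadLoss H M (rwindow k d w s ω) (x ω) - quadLoss H M (rwindow k d w s ω) θs|
      ≤ G)
    (hint : ∀ θ, Integrable (fun ω => quadLoss H M (rwindow k d w 0 ω) θ) μ)
    (hgrow : ∀ θ, c * ‖θ - θs‖ ^ 2 ≤ ∫ ω, quadLoss H M (rwindow k d w 0 ω) θ ∂μ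
      - ∫ ω, quadLoss H M (rwindow k d w 0 ω) θs ∂μ) (l : ℕ) :
    c * ∫ ω, ‖x ω - θs‖ ^ (l + 2) ∂μ ≤
      ∫ ω, (quadLoss H M (rwindow k d w s ω) (x ω) - quadLoss H M (rwindow k d w s ω) θs)
        * ‖x ω - θs‖ ^ l ∂μ := by
  have hcomap : ∀ τ, MeasurableSpace.comap (datum d w τ) inferInstance ≤ ‹MeasurableSpace Ω› :=
    fun τ => (measurable_datum hd_meas hw_meas τ).comap_le
  have hx' : Measurable x := hx.mono (iSup₂_le fun τ _ => hcomap τ) le_rfl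
  have hZ : Measurable (rwindow k d w s) := measurable_rwindow hd_meas hw_meas k s
  -- The past of `s` and the window from `s` on use disjoint sets of times. This works because the
  -- delayed gradient is evaluated at `x s`, not at the current iterate.
  have hxZ : IndepFun x (rwindow k d w s) μ := by
    have hdisj : Disjoint (Set.Iio s) (Set.Ico s (s + k)) :=
      Set.disjoint_left.2 fun i hi hi' => not_lt.2 hi'.1 hi
    have := indep_iSup_of_disjoint hcomap h_indep hdisj
    exact indep_of_indep_of_le_left
      (indep_of_indep_of_le_right this (measurable_rwindow_iSup k s).comap_le) hx.comap_le
  have hq1 : ∀ θ : Param n p, Measurable fun z : Window n p k => quadLoss H M z θ := fun θ =>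
    measurable_quadLoss measurable_id measurable_const
  have hident : ∀ θ : Param n p, IdentDistrib (fun ω => quadLoss H M (rwindow k d w s ω) θ)
      (fun ω => quadLoss H M (rwindow k d w 0 ω) θ) μ μ := fun θ =>
    (identDistrib_rwindow h_indep h_ident k s).comp (hq1 θ)
  have hints : ∀ θ, Integrable (fun ω => quadLoss H M (rwindow k d w s ω) θ) μ := fun θ =>
    (hident θ).integrable_iff.2 (hint θ)
  have hnorm : Measurable fun ω => ‖x ω - θs‖ := (hx'.sub_const θs).norm
  have hbdd : ∀ j ω, ‖‖x ω - θs‖ ^ j‖ ≤ D ^ j := fun j ω => by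
    rw [norm_pow, norm_norm]
    exact pow_le_pow_left₀ (norm_nonneg _) (hD ω) j
  have hY : Integrable (fun ω => quadLoss H M (rwindow k d w s ω) (x ω)
      - quadLoss H M (rwindow k d w s ω) θs) μ :=
    Integrable.of_bound ((measurable_quadLoss hZ hx').sub
      (measurable_quadLoss hZ measurable_const)).aestronglyMeasurable G hG
  rw [← integral_const_mul]
  refine le_integral_of_indepFun hx' hZ hxZ
    (f := fun q => (quadLoss H M q.2 q.1 - quadLoss H M q.2 θs) * ‖q.1 - θs‖ ^ l)
    (g := fun θ => c * ‖θ - θs‖ ^ (l + 2)) ?_ ?_ ?_ ?_ fun θ => ?_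
  · exact ((measurable_quadLoss measurable_snd measurable_fst).sub
      (measurable_quadLoss measurable_snd measurable_const)).mul
      (((measurable_fst.sub_const θs).norm).pow_const l)
  · exact hY.mul_bdd (c := D ^ l) (hnorm.pow_const l).aestronglyMeasurable (ae_of_all _ (hbdd l))
  · exact (((measurable_id.sub_const θs).norm).pow_const (l + 2)).const_mul c
  · exact (Integrable.of_bound (hnorm.pow_const (l + 2)).aestronglyMeasurable (D ^ (l + 2))
      (ae_of_all _ (hbdd (l + 2)))).const_mul c
  · dsimp only
    rw [integral_mul_const, integral_sub (hints θ) (hints θs), (hident θ).integral_eq,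
      (hident θs).integral_eq, add_comm l 2, pow_add, ← mul_assoc]
    exact mul_le_mul_of_nonneg_right (hgrow θ) (by positivity)

/-- The iteration converges to the minimizer of the expected loss if this loss grows
quadratically. -/
theorem ae_tendsto_iterate (hk : 1 ≤ k) (hΘ_closed : IsClosed Θ) (hΘ : Convex ℝ Θ)
    (hΘ_bdd : Bornology.IsBounded Θ) (hθ₀ : θ₀ ∈ Θ)
    (hη_pos : ∀ t, 0 < η t) (hη_anti : Antitone η) (hη_div : ¬ Summable η)
    (hη_pow : ∃ r : ℕ, Summable fun t => η t ^ r)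
    (hd_meas : ∀ τ t, Measurable (d τ t)) (hw_meas : ∀ τ, Measurable (w τ))
    (h_indep : iIndepFun (datum d w) μ)
    (h_ident : ∀ τ t, t ≤ τ →
      IdentDistrib (fun ω => (d τ t ω, w τ ω)) (fun ω => (d 0 0 ω, w 0 ω)) μ μ)
    (hH : H.PosSemidef) {G : ℝ}
    (h_grad : ∀ s, ∀ᵐ ω ∂μ, ∀ θ ∈ Θ, ‖gradient (quadLoss H M (rwindow k d w s ω)) θ‖ ≤ G)
    {θs : Param n p} (hθs : θs ∈ Θ)
    (hint : ∀ θ, Integrable (fun ω => quadLoss H M (rwindow k d w 0 ω) θ) μ) {c : ℝ} (hc : 0 < c)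
    (hgrow : ∀ θ, c * ‖θ - θs‖ ^ 2 ≤ ∫ ω, quadLoss H M (rwindow k d w 0 ω) θ ∂μ
      - ∫ ω, quadLoss H M (rwindow k d w 0 ω) θs ∂μ)
    {x : ℕ → Ω → Param n p} (h0 : ∀ ω, x 0 ω = θ₀)
    (hstep : ∀ t ω, IsProj Θ (x t ω - η t • (if t < k then 0 else
      gradient (quadLoss H M (rwindow k d w (t + 1 - k) ω)) (x (t + 1 - k) ω))) (x (t + 1) ω)) :
    ∀ᵐ ω ∂μ, Tendsto (fun t => x t ω) atTop (𝓝 θs) := by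
  have hxΘ : ∀ t ω, x t ω ∈ Θ := by
    intro t ω
    rcases t with _ | t
    · rw [h0]; exact hθ₀
    · exact (hstep t ω).1
  obtain ⟨D, hD⟩ : ∃ D, ∀ t ω, ‖x t ω - θs‖ ≤ D := by
    obtain ⟨D, hD⟩ := Metric.isBounded_iff.1 hΘ_bdd
    exact ⟨D, fun t ω => by rw [← dist_eq_norm]; exact hD (hxΘ t ω) hθs⟩
  have hxm := measurable_iterate (η := η) hk hΘ hΘ_closed ⟨θ₀, hθ₀⟩ hH h0 hstep
  have hxm' : ∀ t, Measurable (x t) := fun t => (hxm t).mono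
    (iSup₂_le fun τ _ => (measurable_datum hd_meas hw_meas τ).comap_le) le_rfl
  have hgrad' : ∀ᵐ ω ∂μ, ∀ s, ∀ θ ∈ Θ,
      ‖gradient (quadLoss H M (rwindow k d w s ω)) θ‖ ≤ |G| :=
    ae_all_iff.2 fun s => (h_grad s).mono fun ω h θ hθ => (h θ hθ).trans (le_abs_self G)
  -- The gap in loss values bounds the inner product with the gradient from below by convexity, and
  -- its average is what quadratic growth controls. It is bounded because the loss is Lipschitz on
  -- `Θ`.
  set Y : ℕ → Ω → ℝ := fun s ω =>
    quadLoss H M (rwindow k d w s ω) (x s ω) - quadLoss H M (rwindow k d w s ω) θs with hYdef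
  have hYb : ∀ s, ∀ᵐ ω ∂μ, |Y s ω| ≤ |G| * D := fun s => by
    filter_upwards [hgrad'] with ω hω
    exact (abs_quadLoss_sub_le hΘ (hω s) (hxΘ s ω) hθs).trans
      (mul_le_mul_of_nonneg_left (hD s ω) (abs_nonneg _))
  have hYint : ∀ s, Integrable (Y s) μ := fun s => by
    have hZ := measurable_rwindow hd_meas hw_meas k s
    exact Integrable.of_bound ((measurable_quadLoss hZ (hxm' s)).sub
      (measurable_quadLoss hZ measurable_const)).aestronglyMeasurable (|G| * D) (hYb s)
  refine ae_tendsto_of_delayed_gradient_step hk hη_pos hη_anti hη_div hη_pow (D := D) (G := |G|)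
    (c := c) (Y := Y) (g := fun s ω => gradient (quadLoss H M (rwindow k d w s ω)) (x s ω))
    (abs_nonneg G) hc (fun t => ((hxm' t).sub_const θs).norm) hD ?_ ?_ ?_ hYint ?_ ?_
  · filter_upwards [hgrad'] with ω hω s
    exact hω s _ (hxΘ s ω)
  · filter_upwards [hgrad'] with ω hω t
    have h1 := (hstep t ω).dist_le hΘ (isProj_self (hxΘ t ω))
    rw [dist_eq_norm, dist_eq_norm] at h1
    refine h1.trans ?_
    rw [sub_sub_cancel_left, norm_neg, norm_smul, Real.norm_of_nonneg (hη_pos t).le, mul_comm]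
    refine mul_le_mul_of_nonneg_right ?_ (hη_pos t).le
    by_cases htk : t < k
    · simp [htk]
    · simpa only [htk, if_false] using hω _ _ (hxΘ _ ω)
  -- Since `θs` lies in `Θ` it is its own projection, so projecting does not increase the distance
  -- to it.
  · refine ae_of_all _ fun ω j => ?_
    have h1 := (hstep (j + k) ω).dist_le hΘ (isProj_self hθs)
    rwa [if_neg (by omega), show j + k + 1 - k = j + 1 by omega, dist_eq_norm, dist_eq_norm] at h1
  · exact ae_of_all _ fun ω s => quadLoss_sub_le_inner_gradient hH _ _ _
  · exact fun s l => le_integral_quadLoss_sub_mul h_indep h_ident hd_meas hw_meas (hxm s) (hD s)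
      (hYb s) hint hgrow l

end Convergence

/-- Under the data assumptions, a unique minimizer of the expected losses is `[0, E w]`, and the
expected loss over a window is integrable and grows quadratically around it. -/
lemma exists_quadratic_growth {n p k : ℕ} (i₀ : Fin n) {Ω : Type*}
    [MeasurableSpace Ω] {μ : Measure Ω} [IsProbabilityMeasure μ]
    {d : ℕ → ℕ → Ω → Fin p → ℝ} {w : ℕ → Ω → Fin n → ℝ}
    {H : Matrix (Fin n) (Fin n) ℝ} {M₁ : Fin 1 → Matrix (Fin n) (Fin n) ℝ}
    {M : Fin k → Matrix (Fin n) (Fin n) ℝ} (hH : H.PosSemidef)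
    (hd_meas : ∀ τ t, Measurable (d τ t)) (hw_meas : ∀ τ, Measurable (w τ))
    (hw_bdd : ∃ W : ℝ, ∀ τ, ∀ᵐ ω ∂μ, ‖w τ ω‖ ≤ W)
    (h_indep : iIndepFun (datum d w) μ)
    (h_ident : ∀ τ t, t ≤ τ →
      IdentDistrib (fun ω => (d τ t ω, w τ ω)) (fun ω => (d 0 0 ω, w 0 ω)) μ μ)
    (h_uncorr : ∀ (j : Fin p) (i : Fin n), cov[fun ω => d 0 0 ω j, fun ω => w 0 ω i; μ] = 0)
    {θ₁ θs : Param n p}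
    (hmin₁ : ∀ θ, θ ≠ θ₁ → ∫ ω, quadLoss H M₁ (rwindow 1 d w 0 ω) θ₁ ∂μ <
      ∫ ω, quadLoss H M₁ (rwindow 1 d w 0 ω) θ ∂μ)
    (hmin : ∀ θ, θ ≠ θs → ∫ ω, quadLoss H M (rwindow k d w 0 ω) θs ∂μ <
      ∫ ω, quadLoss H M (rwindow k d w 0 ω) θ ∂μ) :
    θs = constParam p (∫ ω, w 0 ω ∂μ) ∧
    (∀ θ, Integrable (fun ω => quadLoss H M (rwindow k d w 0 ω) θ) μ) ∧
    ∃ c > 0, ∀ θ, c * ‖θ - θs‖ ^ 2 ≤ ∫ ω, quadLoss H M (rwindow k d w 0 ω) θ ∂μ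
      - ∫ ω, quadLoss H M (rwindow k d w 0 ω) θs ∂μ := by
  obtain ⟨W, hW⟩ := hw_bdd
  have hwL2 : ∀ τ i, MemLp (fun ω => w τ ω i) 2 μ := fun τ i => by
    refine MemLp.of_bound ((measurable_pi_apply i).comp (hw_meas τ)).aestronglyMeasurable W ?_
    filter_upwards [hW τ] with ω hω
    exact (norm_le_pi_norm (w τ ω) i).trans hω
  have hdL2 : ∀ a, MemLp (fun ω => d 0 0 ω a) 2 μ := fun a =>
    memLp_embedding_of_unique_minimizer (Z := rwindow 1 d w 0) hH i₀
      (measurable_rwindow hd_meas hw_meas 1 0) (fun i => hwL2 0 i) hmin₁ a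
  have hd : ∀ (j : Fin k) a, MemLp (fun ω => (rwindow k d w 0 ω j).1 a) 2 μ := fun j a => by
    have h1 : IdentDistrib (fun ω => (rwindow k d w 0 ω j).1 a) (fun ω => d 0 0 ω a) μ μ :=
      (h_ident (0 + j) 0 (by omega)).comp
        (u := fun x : (Fin p → ℝ) × (Fin n → ℝ) => x.1 a) (by fun_prop)
    exact h1.memLp_iff.2 (hdL2 a)
  have hwm : ∀ i, (∫ ω, w 0 ω ∂μ) i = ∫ ω, w 0 ω i ∂μ := fun i =>
    eval_integral (fun i => (hwL2 0 i).integrable one_le_two) i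
  have hw : ∀ (j : Fin k) i, MemLp (fun ω => (rwindow k d w 0 ω j).2 i) 2 μ := fun j i =>
    hwL2 (0 + j) i
  obtain ⟨hθs, c, hc, hgrow⟩ := eq_constParam_of_unique_minimizer hH hd hw
    (b := ∫ ω, w 0 ω ∂μ) (fun j i => by
      have h1 : IdentDistrib (fun ω => (rwindow k d w 0 ω j).2 i) (fun ω => w 0 ω i) μ μ :=
        (h_ident (0 + j) 0 (by omega)).comp
          (u := fun x : (Fin p → ℝ) × (Fin n → ℝ) => x.2 i) (by fun_prop)
      rw [h1.integral_eq, hwm])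
    (fun j j' i a => by
      rw [hwm]
      exact integral_centred_mul_embedding h_indep h_ident h_uncorr hdL2 (hwL2 0) hd_meas hw_meas
        k 0 j j' i a) hmin
  exact ⟨hθs, integrable_quadLoss hd hw, c, hc, by rwa [hθs]⟩

end InstructMPC

/-! ### The convergence theorem. -/

theorem theorem2 {n m p : ℕ}
    -- the linear-quadratic control problem
    (A : Matrix (Fin n) (Fin n) ℝ) (B : Matrix (Fin n) (Fin m) ℝ)
    (Q : Matrix (Fin n) (Fin n) ℝ) (R : Matrix (Fin m) (Fin m) ℝ)
    (P : Matrix (Fin n) (Fin n) ℝ)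
    (hQ : Q.PosDef) (hR : R.PosDef) (hP : InstructMPC.IsDARESolution A B Q R P)
    -- over-actuation: `B` has full row rank
    (hB : B.rank = n)
    -- prediction window, hypothesis set, initial parameter, learning rates
    (k : ℕ) (hk : 1 ≤ k)
    (Θ : Set (InstructMPC.Param n p)) (hΘ_closed : IsClosed Θ) (hΘ_convex : Convex ℝ Θ)
    (hΘ_bdd : Bornology.IsBounded Θ)
    (θ₀ : InstructMPC.Param n p) (hθ₀ : θ₀ ∈ Θ)
    (η : ℕ → ℝ) (hη_pos : ∀ t, 0 < η t) (hη_anti : Antitone η) (hη_div : ¬ Summable η)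
    (hη_pow : ∃ r : ℕ, Summable fun t => η t ^ r)
    -- random data: `d τ t` is the embedding for time `τ` available at time `t ≤ τ`
    {Ω : Type*} [MeasurableSpace Ω] (μ : Measure Ω) [IsProbabilityMeasure μ]
    (d : ℕ → ℕ → Ω → Fin p → ℝ) (w : ℕ → Ω → Fin n → ℝ)
    (hd_meas : ∀ τ t, Measurable (d τ t)) (hw_meas : ∀ τ, Measurable (w τ))
    (hw_bdd : ∃ W : ℝ, ∀ τ, ∀ᵐ ω ∂μ, ‖w τ ω‖ ≤ W)
    -- the data of different times are independent
    (h_indep : iIndepFun (fun (τ : ℕ) (ω : Ω) => ((fun t : Fin (τ + 1) => d τ t ω), w τ ω)) μ)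
    -- and all pairs of an embedding and the disturbance of the same time have the same law
    (h_ident : ∀ τ t, t ≤ τ →
      IdentDistrib (fun ω => (d τ t ω, w τ ω)) (fun ω => (d 0 0 ω, w 0 ω)) μ μ)
    -- the entries of an embedding are pairwise independent
    (h_entries : Pairwise fun i j => IndepFun (fun ω => d 0 0 ω i) (fun ω => d 0 0 ω j) μ)
    -- embedding and disturbance are uncorrelated
    (h_uncorr : ∀ (j : Fin p) (i : Fin n), cov[fun ω => d 0 0 ω j, fun ω => w 0 ω i; μ] = 0)
    -- the gradients of the losses are uniformly bounded on `Θ`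
    (h_grad : ∃ G : ℝ, ∀ T t, t < T → ∀ᵐ ω ∂μ, ∀ θ ∈ Θ,
      ‖gradient (InstructMPC.loss A B R P k T (fun τ s => d τ s ω) (fun τ => w τ ω) t) θ‖ ≤ G)
    -- the unconstrained minimizer of the expected loss lies in the interior of `Θ`
    (h_min : ∀ T t, t < T → ∃ θs ∈ interior Θ, ∀ θ, θ ≠ θs →
      ∫ ω, InstructMPC.loss A B R P k T (fun τ s => d τ s ω) (fun τ => w τ ω) t θs ∂μ <
        ∫ ω, InstructMPC.loss A B R P k T (fun τ s => d τ s ω) (fun τ => w τ ω) t θ ∂μ)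
    -- `θ T t ω` is the parameter at time `t` of the run with horizon `T`
    (θ : ℕ → ℕ → Ω → InstructMPC.Param n p)
    (h_run : ∀ T ω, InstructMPC.IsRun k T Θ η θ₀
      (InstructMPC.loss A B R P k T (fun τ s => d τ s ω) (fun τ => w τ ω)) (fun t => θ T t ω)) :
    ∀ᵐ ω ∂μ,
      Tendsto (fun q : ℕ × ℕ => InstructMPC.matC (θ q.1 q.2 ω)) InstructMPC.largeTime (𝓝 0) ∧
      Tendsto (fun q : ℕ × ℕ => InstructMPC.vecb (θ q.1 q.2 ω)) InstructMPC.largeTime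
        (𝓝 (∫ ω', w 0 ω' ∂μ)) := by
  -- For `n = 0` both targets are one-point spaces; otherwise a row index exists, as the
  -- square-integrability argument requires.
  rcases Nat.eq_zero_or_pos n with rfl | hn
  · refine ae_of_all _ fun ω => ⟨?_, ?_⟩
    · rw [Subsingleton.elim (fun q : ℕ × ℕ => InstructMPC.matC (θ q.1 q.2 ω)) fun _ => 0]
      exact tendsto_const_nhds
    · rw [Subsingleton.elim (fun q : ℕ × ℕ => InstructMPC.vecb (θ q.1 q.2 ω))
        fun _ => ∫ ω', w 0 ω' ∂μ]
      exact tendsto_const_nhds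
  have hH := InstructMPC.posSemidef_matH (B := B) hR hP.posSemidef
  have hloss : ∀ (T t K : ℕ) (ω : Ω), InstructMPC.lastIdx k T t + 1 = t + K →
      InstructMPC.loss A B R P k T (fun τ s => d τ s ω) (fun τ => w τ ω) t =
        InstructMPC.quadLoss (InstructMPC.matH B R P) (InstructMPC.weights A B R P K)
          (InstructMPC.rwindow K d w t ω) := fun T t K ω hK =>
    InstructMPC.loss_eq_quadLoss A B R P hK _ _
  -- Horizon one truncates the window to a single entry whatever `k` is; horizon `k` below gives the
  -- full window at time `0`.
  obtain ⟨θ₁, -, hmin₁⟩ := h_min 1 0 one_pos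
  simp only [hloss 1 0 1 _ (by simp [InstructMPC.lastIdx])] at hmin₁
  obtain ⟨θs, hθs, hmin⟩ := h_min k 0 hk
  have hlast : ∀ s, InstructMPC.lastIdx k (s + k) s + 1 = s + k := fun s =>
    InstructMPC.lastIdx_add_one hk le_rfl
  simp only [hloss k 0 k _ (InstructMPC.lastIdx_add_one hk (by omega))] at hmin
  obtain ⟨hθs_eq, hint, c, hc, hgrow⟩ := InstructMPC.exists_quadratic_growth ⟨0, hn⟩ hH hd_meas
    hw_meas hw_bdd h_indep h_ident h_uncorr hmin₁ hmin
  obtain ⟨G, hG⟩ := h_grad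
  have hagree : ∀ T t ω, t ≤ T → θ T t ω = θ t t ω := fun T t ω ht =>
    (h_run T ω).eq_of_le hk hΘ_convex (h_run t ω) t ht le_rfl
  -- The common trajectory is the diagonal `θ t t`, whose step at `t` is read off the run with
  -- horizon `t + 1`. The gradient bound for the window at `s` comes from horizon `s + k`, the first
  -- that contains it.
  have hconv := InstructMPC.ae_tendsto_iterate (x := fun t ω => θ t t ω) hk hΘ_closed hΘ_convex
    hΘ_bdd hθ₀ hη_pos hη_anti hη_div hη_pow hd_meas hw_meas h_indep h_ident hH (G := G)
    (fun s => by simpa only [hloss (s + k) s k _ (hlast s)] using hG (s + k) s (by omega))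
    (interior_subset hθs) hint hc hgrow (fun ω => (h_run 0 ω).init) (fun t ω => by
      have h1 := (h_run (t + 1) ω).isProj_step hk (Nat.lt_succ_self t)
      rw [hagree (t + 1) t ω (Nat.le_succ t)] at h1
      by_cases htk : t < k
      · simpa only [htk, if_true] using h1
      · simp only [htk, if_false] at h1 ⊢
        rwa [hagree (t + 1) (t + 1 - k) ω (by omega)] at h1)
  filter_upwards [hconv] with ω hω
  have hlim : Tendsto (fun q : ℕ × ℕ => θ q.1 q.2 ω) InstructMPC.largeTime (𝓝 θs) := by
    have h1 : Tendsto (fun q : ℕ × ℕ => θ q.2 q.2 ω) InstructMPC.largeTime (𝓝 θs) :=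
      hω.comp (tendsto_comap.mono_left inf_le_left)
    refine h1.congr' ?_
    have hmem : {q : ℕ × ℕ | q.2 < q.1} ∈ InstructMPC.largeTime :=
      mem_inf_of_right (mem_principal_self _)
    filter_upwards [hmem] with q hq
    exact (hagree q.1 q.2 ω (le_of_lt hq)).symm
  have hcoord : ∀ a, Tendsto (fun q : ℕ × ℕ => θ q.1 q.2 ω a) InstructMPC.largeTime
      (𝓝 (InstructMPC.constParam p (∫ ω', w 0 ω' ∂μ) a)) := fun a => by
    rw [← hθs_eq]
    exact ((EuclideanSpace.proj a).continuous.tendsto θs).comp hlim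
  exact ⟨tendsto_pi_nhds.2 fun i => tendsto_pi_nhds.2 fun j => hcoord (Sum.inl (i, j)),
    tendsto_pi_nhds.2 fun i => hcoord (Sum.inr i)⟩
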